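/- **Setting.** Let $X\subset\mathbb{R}^d$ be compact and convex, let $M,N\in\mathbb{N}\cup\{\infty\}$, and let $$\mu^-=\sum_{i=1}^M m_i'\,\delta_{x_i},\qquad \mu^+=\sum_{j=1}^N m_j\,\delta_{y_j},\qquad \sum_{i=1}^M m_i'=\sum_{j=1}^N m_j<\infty ,$$ with $x_i,y_j\in X$ and $m_i',m_j\ge 0$. *Currents.* A 1-current $T$ on $\mathbb{R}^d$ is a continuous linear functional on smooth compactly supported 1-forms; $\mathbf M(T)$ is its mass, $\partial T(f)=T(df)$ its boundary; it is normal if $\mathbf M(T)+\mathbf M(\partial T)<\infty$, and rectifiable if $T(\omega)=\int_R\langle\omega,\xi\rangle\,\theta\,d\mathcal H^1$ for an $\mathcal H^1$-measurable countably 1-rectifiable set $R$, a positive locally $\mathcal H^1$-integrable $\theta$ on $R$ and an $\mathcal H^1$-measurable $\xi$ which a.e. is a unit vector spanning the approximate tangent line of $R$. A 1-current $S$ is a subcurrent of $T$ if $\mathbf M(T-S)+\mathbf M(S)=\mathbf M(T)$. *Paths and maps.* For finite Borel measures $\mu,\nu$ supported on $X$ of equal mass, $Path(\mu,\nu)$ is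 the set of rectifiable 1-currents $T$ with $\partial T=\nu-\mu$, and $Map(\mu,\nu)$ is the set of Borel maps $\varphi:X\to X$ with $\varphi_\#\mu=\nu$. *Curves.* $\Gamma$ is the space of eventually constant 1-Lipschitz curves $\gamma:[0,\infty)\to\mathbb{R}^d$ with the topology of uniform convergence on compact sets; $p_0(\gamma)=\gamma(0)$, $p_\infty(\gamma)=\lim_{t\to\infty}\gamma(t)$, $\Gamma_{x,y}=\{\gamma\in\Gamma: p_0(\gamma)=x,\ p_\infty(\gamma)=y\}$. A curve is simple if it is injective on $[t_0,t_\infty]$, where $[0,t_0]$ and $[t_\infty,\infty)$ are the maximal initial and final intervals on which it is constant. For simple $\gamma$, $I_\gamma(\omega)=\int_{\mathrm{Im}\,\gamma}\langle\omega,\gamma'/|\gamma'|\rangle\,d\mathcal H^1$. The equation $T=\int_\Gamma I_\gamma\,d\eta$ means $T(\omega)=\int_\Gamma I_\gamma(\omega)\,d\eta(\gamma)$ for all $\omega$. *Good decompositions.* A finite positive Borel measure $\eta$ on $\Gamma$, concentrated on non-constant simple curves, is a good decomposition of a normal 1-current $T$ if $T=\int_\Gamma I_\gamma\,d\eta$,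 $\mathbf M(T)=\int_\Gamma\mathbf M(I_\gamma)\,d\eta=\int_\Gamma\mathcal H^1(\mathrm{Im}\,\gamma)\,d\eta$ and $\mathbf M(\partial T)=\int_\Gamma\mathbf M(\partial I_\gamma)\,d\eta=2\eta(\Gamma)$. *Stair-shaped.* An $M\times N$ matrix $A$ with non-negative entries is stair-shaped if there are non-decreasing sequences $r_k\in\{1,\dots,M\}$ and $c_k\in\{1,\dots,N\}$, $1\le k\le M+N-1$ ($k$ and the index ranges being unbounded where infinite), with $r_k+c_k=k+1$, such that all entries of $A$ outside the positions $(r_k,c_k)$ are zero. A path $T\in Path(\mu^-,\mu^+)$ is stair-shaped if it has a good decomposition $\eta$ with $(p_0)_\#\eta=\mu^-$ and $(p_\infty)_\#\eta=\mu^+$ whose representing matrix $[\eta(\Gamma_{x_i,y_j})]_{ij}$ is stair-shaped. *Compatibility.* For $T\in Path(\mu,\nu)$ and $\varphi\in Map(\mu,\nu)$, the pair $(T,\varphi)$ is compatible if there is a finite Borel measure $\eta$ on $\Gamma$, concentrated on simple curves, with $T=\int_\Gamma I_\gamma\,d\eta$ and $(\mathrm{id}\times\varphi)_\#\mu=\int_\Gamma\delta_{(p_0(\gamma),p_\infty(\gamma))}\,d\eta$.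 **Theorem.** Let $T\in Path(\mu^-,\mu^+)$ be a stair-shaped transport path. Then there exist decompositions $$\mu^-=\mu_1^-+\mu_2^-,\qquad \mu^+=\mu_1^++\mu_2^+,\qquad T=T_1+T_2$$ such that (a) for each $i=1,2$, $T_i$ is a subcurrent of $T$ and $T_i\in Path(\mu_i^-,\mu_i^+)$; (b) there exist transport maps $\varphi\in Map(\mu_1^-,\mu_1^+)$ and $\psi\in Map(\mu_2^+,\mu_2^-)$ such that both $(T_1,\varphi)$ and $(-T_2,\psi)$ are compatible. -/

import Mathlib

open MeasureTheory Set Filter Topology TopologicalSpace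
open scoped NNReal ENNReal Distributions

noncomputable section

namespace TransportPaths

/-- The Euclidean space `ℝ^d`. -/
abbrev E (d : ℕ) : Type := EuclideanSpace ℝ (Fin d)

/-! ### Currents -/

/-- Compactly supported smooth functions (0-forms) on `ℝ^d`. -/
abbrev Form0 (d : ℕ) : Type := 𝓓((⊤ : Opens (E d)), ℝ)

/-- Compactly supported smooth 1-forms on `ℝ^d`. The norm of a covector is its Euclidean norm. -/
abbrev Form1 (d : ℕ) : Type := 𝓓((⊤ : Opens (E d)), E d →L[ℝ] ℝ)

/-- The exterior derivative of 0-forms. -/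
def extDeriv0 {d : ℕ} : Form0 d →L[ℝ] Form1 d := TestFunction.fderivCLM ℝ ⊤ ⊤

/-- 1-currents on `ℝ^d`: continuous linear functionals on the smooth compactly supported 1-forms
(with their usual LF topology). -/
abbrev Current1 (d : ℕ) : Type := Form1 d →L[ℝ] ℝ

/-- The mass of a functional on compactly supported smooth forms (of degree 0 or 1): the supremum
of its values at the forms of pointwise norm at most one. -/
def mass {d : ℕ} {V : Type} [NormedAddCommGroup V] [NormedSpace ℝ V]
    (F : 𝓓((⊤ : Opens (E d)), V) → ℝ) : ℝ≥0∞ :=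
  ⨆ (ω : 𝓓((⊤ : Opens (E d)), V)) (_ : ∀ x, ‖ω x‖ ≤ 1), ENNReal.ofReal (F ω)

/-- The boundary: `∂T (f) = T (df)`. -/
def boundary {d : ℕ} (F : Form1 d → ℝ) : Form0 d → ℝ := fun f => F (extDeriv0 f)

/-- Normal 1-currents: mass and mass of the boundary are finite. -/
def IsNormal {d : ℕ} (T : Current1 d) : Prop := mass T + mass (boundary T) < ∞

/-- `S` is a subcurrent of `T`. -/
def IsSubcurrent {d : ℕ} (S T : Current1 d) : Prop := mass (T - S : Current1 d) + mass S = mass T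

/-! ### Rectifiable 1-currents -/

/-- Countably 1-rectifiable subsets of `ℝ^d`. -/
def IsCountablyRectifiable {d : ℕ} (M : Set (E d)) : Prop :=
  ∃ (M₀ : Set (E d)) (F : ℕ → ℝ → E d), μH[1] M₀ = 0 ∧ (∀ j, ∃ K : ℝ≥0, LipschitzWith K (F j)) ∧
    M ⊆ M₀ ∪ ⋃ j, range (F j)

/-- The line `P` is the approximate tangent space at `x` of the set `M` with density `θ`: the
rescalings of `θ` times the Hausdorff measure on `M` about `x` converge, against continuous
compactly supported functions, to `θ x` times the Hausdorff measure on `P`. -/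
def IsApproxTangentLine {d : ℕ} (M : Set (E d)) (θ : E d → ℝ) (x : E d)
    (P : Submodule ℝ (E d)) : Prop :=
  Module.finrank ℝ P = 1 ∧
  ∀ f : E d → ℝ, Continuous f → HasCompactSupport f →
    Tendsto (fun r : ℝ => ∫ y in {y | x + r • y ∈ M}, f y * θ (x + r • y) ∂μH[1]) (𝓝[>] 0)
      (𝓝 (θ x * ∫ y in (P : Set (E d)), f y ∂μH[1]))

/-- The functional `ω ↦ ∫_M ⟨ω, ξ⟩ θ dℋ¹` on 1-forms. -/
def tauFunctional {d : ℕ} (M : Set (E d)) (θ : E d → ℝ) (ξ : E d → E d) : Form1 d → ℝ :=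
  fun ω => ∫ x in M, ω x (ξ x) * θ x ∂μH[1]

/-- Rectifiable 1-currents: `T (ω) = ∫_M ⟨ω, ξ⟩ θ dℋ¹` for a measurable countably 1-rectifiable
set `M`, a positive locally integrable multiplicity `θ`, and a measurable orientation `ξ` that
almost everywhere is a unit vector spanning the approximate tangent line. -/
def IsRectifiable {d : ℕ} (T : Current1 d) : Prop :=
  ∃ (M : Set (E d)) (θ : E d → ℝ) (ξ : E d → E d),
    NullMeasurableSet M μH[1] ∧ IsCountablyRectifiable M ∧
    (∀ x ∈ M, 0 < θ x) ∧ LocallyIntegrable θ (μH[1].restrict M) ∧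
    AEStronglyMeasurable ξ (μH[1].restrict M) ∧
    (∀ᵐ x ∂(μH[1].restrict M), ‖ξ x‖ = 1 ∧
      ∃ P : Submodule ℝ (E d), IsApproxTangentLine M θ x P ∧ ξ x ∈ P) ∧
    ∀ ω, T ω = tauFunctional M θ ξ ω

/-! ### The space of curves -/

/-- The space `Γ` of 1-Lipschitz curves `[0,∞) → ℝ^d` that are eventually constant. -/
def Curve (d : ℕ) : Type :=
  {γ : C(ℝ≥0, E d) // LipschitzWith 1 γ ∧ ∃ t, ∀ s, t ≤ s → γ s = γ t}

/-- The topology of uniform convergence on compact sets. -/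
instance (d : ℕ) : TopologicalSpace (Curve d) :=
  inferInstanceAs (TopologicalSpace
    {γ : C(ℝ≥0, E d) // LipschitzWith 1 γ ∧ ∃ t, ∀ s, t ≤ s → γ s = γ t})

/-- The Borel sigma-algebra. -/
instance (d : ℕ) : MeasurableSpace (Curve d) := borel (Curve d)

instance (d : ℕ) : BorelSpace (Curve d) := ⟨rfl⟩

instance (d : ℕ) : CoeFun (Curve d) (fun _ => ℝ≥0 → E d) := ⟨fun γ => γ.1⟩

namespace Curve

variable {d : ℕ}

/-- The starting point `p₀ (γ) = γ (0)`. -/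
def startPoint (γ : Curve d) : E d := γ 0

/-- The end point `p_∞ (γ) = lim_{t → ∞} γ (t)`. -/
def endPoint (γ : Curve d) : E d := limUnder atTop (γ : ℝ≥0 → E d)

/-- The last time up to which the curve rests at its starting point (`0` by convention for a
constant curve). -/
def t₀ (γ : Curve d) : ℝ≥0 := sSup {t | ∀ s, s ≤ t → γ s = γ 0}

/-- The first time from which on the curve rests. -/
def tStop (γ : Curve d) : ℝ≥0 := sInf {t | ∀ s, t ≤ s → γ s = γ t}

/-- Simple curves. -/
def IsSimple (γ : Curve d) : Prop := ∀ s t, γ.t₀ ≤ s → s < t → t ≤ γ.tStop → γ s ≠ γ t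

/-- Non-constant curves. -/
def IsNonconstant (γ : Curve d) : Prop := ∃ s t, γ s ≠ γ t

/-- The unit tangent field `γ' / |γ'|` on the image of a curve: at `x = γ (t)` it is
`γ' (t) / |γ' (t)|`, with `t` the (first) time at which the curve is at `x`. For a simple curve this
time is unique unless `x` is an end point of the curve; where the derivative vanishes or does not
exist, which is a null set of points, the value is `0`. -/
def unitTangent (γ : Curve d) (x : E d) : E d :=
  let v : E d := deriv (fun s : ℝ => γ s.toNNReal) ((sInf {t : ℝ≥0 | γ t = x} : ℝ≥0) : ℝ)
  ‖v‖⁻¹ • v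

/-- The current `I_γ` carried by the image of a simple curve, with multiplicity one and
orientation `γ' / |γ'|`. -/
def toFunctional (γ : Curve d) : Form1 d → ℝ :=
  tauFunctional (range γ) (fun _ => 1) γ.unitTangent

/-- The set `Γ_{x,y}` of curves from `x` to `y`. -/
def between (x y : E d) : Set (Curve d) := {γ | γ.startPoint = x ∧ γ.endPoint = y}

theorem tendsto_endPoint (γ : Curve d) : Tendsto (γ : ℝ≥0 → E d) atTop (𝓝 γ.endPoint) := by
  obtain ⟨t, ht⟩ := γ.2.2
  have h : Tendsto (γ : ℝ≥0 → E d) atTop (𝓝 (γ t)) :=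
    tendsto_const_nhds.congr' (by
      filter_upwards [eventually_ge_atTop t] with s hs using (ht s hs).symm)
  exact tendsto_nhds_limUnder ⟨_, h⟩

theorem measurable_eval (t : ℝ≥0) : Measurable (fun γ : Curve d => γ t) := by
  have h : Continuous (fun γ : Curve d => γ t) :=
    (continuous_eval_const (F := C(ℝ≥0, E d)) t).comp continuous_subtype_val
  exact h.measurable

theorem measurable_startPoint : Measurable (startPoint : Curve d → E d) := measurable_eval 0

theorem measurable_endPoint : Measurable (endPoint : Curve d → E d) := by
  refine measurable_of_tendsto_metrizable (f := fun (n : ℕ) (γ : Curve d) => γ (n : ℝ≥0))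
    (fun n => measurable_eval _) ?_
  rw [tendsto_pi_nhds]
  intro γ
  exact γ.tendsto_endPoint.comp tendsto_natCast_atTop_atTop

end Curve

/-- `T = ∫_Γ I_γ dη (γ)`, i.e. `T (ω) = ∫_Γ I_γ (ω) dη (γ)` for every `ω`. -/
def IsIntegralOfCurves {d : ℕ} (T : Current1 d) (η : Measure (Curve d)) : Prop :=
  ∀ ω, Integrable (fun γ : Curve d => γ.toFunctional ω) η ∧ T ω = ∫ γ, γ.toFunctional ω ∂η

/-- Good (Smirnov) decompositions of a normal 1-current. -/
structure IsGoodDecomposition {d : ℕ} (T : Current1 d) (η : Measure (Curve d)) : Prop where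
  normal : IsNormal T
  finite : IsFiniteMeasure η
  integral : IsIntegralOfCurves T η
  supported : ∀ᵐ γ ∂η, γ.IsNonconstant ∧ γ.IsSimple
  mass_eq : mass T = ∫⁻ γ, mass γ.toFunctional ∂η
  mass_eq_length : mass T = ∫⁻ γ, μH[1] (range γ) ∂η
  mass_boundary_eq : mass (boundary T) = ∫⁻ γ, mass (boundary γ.toFunctional) ∂η
  mass_boundary_eq_two : mass (boundary T) = 2 * η univ

/-! ### Transport paths, maps and plans -/

/-- `μ` and `ν` are finite Borel measures supported on `X`, of equal total mass. -/
structure IsTransportPair {d : ℕ} (X : Set (E d)) (μ ν : Measure (E d)) : Prop where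
  finite_left : IsFiniteMeasure μ
  finite_right : IsFiniteMeasure ν
  left_supported : μ Xᶜ = 0
  right_supported : ν Xᶜ = 0
  mass_eq : μ univ = ν univ

/-- `T ∈ Path (μ, ν)`: `T` is a rectifiable 1-current with `∂T = ν - μ`. -/
structure IsTransportPath {d : ℕ} (X : Set (E d)) (T : Current1 d) (μ ν : Measure (E d)) :
    Prop where
  pair : IsTransportPair X μ ν
  rectifiable : IsRectifiable T
  boundary_eq : ∀ f : Form0 d, boundary T f = ∫ x, f x ∂ν - ∫ x, f x ∂μ

/-- `φ ∈ Map (μ, ν)`: `φ` is a Borel map from `X` to `X` that pushes `μ` forward to `ν` (the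
values of `φ` outside `X` are irrelevant). -/
structure IsTransportMap {d : ℕ} (X : Set (E d)) (φ : E d → E d) (μ ν : Measure (E d)) :
    Prop where
  pair : IsTransportPair X μ ν
  measurable : Measurable φ
  mapsTo : MapsTo φ X X
  map_eq : μ.map φ = ν

/-- `π ∈ Plan (μ, ν)`. -/
structure IsTransportPlan {d : ℕ} (X : Set (E d)) (π : Measure (E d × E d))
    (μ ν : Measure (E d)) : Prop where
  pair : IsTransportPair X μ ν
  map_fst : π.map Prod.fst = μ
  map_snd : π.map Prod.snd = ν

/-- The pair `(T, π)`, `T ∈ Path (μ, ν)`, `π ∈ Plan (μ, ν)`, is compatible: there is a finite Borel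
measure `η` on `Γ`, carried by the simple curves (those for which `I_γ` is defined), with
`T = ∫ I_γ dη` and `π = ∫ δ_{(p₀ γ, p_∞ γ)} dη`. -/
def IsCompatiblePlan {d : ℕ} (X : Set (E d)) (μ ν : Measure (E d)) (T : Current1 d)
    (π : Measure (E d × E d)) : Prop :=
  IsTransportPath X T μ ν ∧ IsTransportPlan X π μ ν ∧
  ∃ η : Measure (Curve d), IsFiniteMeasure η ∧ (∀ᵐ γ ∂η, γ.IsSimple) ∧
    IsIntegralOfCurves T η ∧ π = η.map (fun γ => (γ.startPoint, γ.endPoint))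

/-- The pair `(T, φ)`, `T ∈ Path (μ, ν)`, `φ ∈ Map (μ, ν)`, is compatible: `(T, (id × φ)_# μ)` is
compatible. -/
def IsCompatibleMap {d : ℕ} (X : Set (E d)) (μ ν : Measure (E d)) (T : Current1 d)
    (φ : E d → E d) : Prop :=
  IsTransportMap X φ μ ν ∧ IsCompatiblePlan X μ ν T (μ.map (fun x => (x, φ x)))

/-! ### Stair-shaped matrices and stair-shaped transport paths -/

/-- The index set with `M ∈ ℕ ∪ {∞}` elements, numbered `0, 1, 2, …`. -/
abbrev Idx (M : ℕ∞) : Type := {i : ℕ // (i : ℕ∞) < M}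

/-- Stair-shaped `M × N` matrices, rows, columns and positions being numbered from `0`: there are
non-decreasing sequences `r`, `c` of `M + N - 1` row and column indices with `r k + c k = k`, such
that the entries at positions other than the `(r k, c k)` vanish. -/
def IsStairMatrix {M N : ℕ∞} (A : Matrix (Idx M) (Idx N) ℝ≥0) : Prop :=
  ∃ r c : ℕ → ℕ,
    (∀ k : ℕ, ((k + 1 : ℕ) : ℕ∞) < M + N →
      r k + c k = k ∧ (r k : ℕ∞) < M ∧ (c k : ℕ∞) < N) ∧
    (∀ k l : ℕ, k ≤ l → ((l + 1 : ℕ) : ℕ∞) < M + N → r k ≤ r l ∧ c k ≤ c l) ∧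
    ∀ (i : Idx M) (j : Idx N),
      (¬ ∃ k : ℕ, ((k + 1 : ℕ) : ℕ∞) < M + N ∧ r k = (i : ℕ) ∧ c k = (j : ℕ)) → A i j = 0

/-- The atomic measure `∑ i, m i δ_{x i}`. -/
def atomic {d : ℕ} {ι : Type} (x : ι → E d) (m : ι → ℝ≥0) : Measure (E d) :=
  Measure.sum fun i => (m i : ℝ≥0∞) • Measure.dirac (x i)

/-- The representing matrix `η (Γ_{x_i, y_j})` of a finite measure `η` on `Γ`. -/
def representingMatrix {d : ℕ} {M N : ℕ∞} (x : Idx M → E d) (y : Idx N → E d)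
    (η : Measure (Curve d)) : Matrix (Idx M) (Idx N) ℝ≥0 :=
  Matrix.of fun i j => (η (Curve.between (x i) (y j))).toNNReal

/-- `T` is stair-shaped: it has a good decomposition `η` with `(p₀)_# η = ∑ m'_i δ_{x_i}` and
`(p_∞)_# η = ∑ m_j δ_{y_j}` whose representing matrix is stair-shaped. -/
def IsStairShaped {d : ℕ} {M N : ℕ∞} (x : Idx M → E d) (m' : Idx M → ℝ≥0) (y : Idx N → E d)
    (m : Idx N → ℝ≥0) (T : Current1 d) : Prop :=
  ∃ η : Measure (Curve d), IsGoodDecomposition T η ∧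
    η.map Curve.startPoint = atomic x m' ∧ η.map Curve.endPoint = atomic y m ∧
    IsStairMatrix (representingMatrix x y η)

end TransportPaths

end

open TransportPaths

/-!
The curves of a good decomposition `η` of a stair-shaped path `T` run, up to a null set, between
pairs `(x i, y j)` at which the representing matrix does not vanish, and these pairs form a chain for
the product order. An element of a chain that is neither the first one of its row nor the first one
of its column cannot exist, since those two first elements would be incomparable. So there are maps
`φ` and `ψ` such that almost every curve ends at the image under `φ` of its starting point, or starts
at the image under `ψ` of its end point (`exists_maps_of_chain`; repeated points are represented by
one index each). Restricting `η` to the curves of the first kind and to the other ones yields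
currents `T₁` and `T₂` with `T = T₁ + T₂`. The first is compatible with `φ`, and the second, with all
its curves run backwards, is compatible with `ψ`. As `η` is mass-optimal, the masses of `T₁` and `T₂`
add up to that of `T`, so both are subcurrents (`IsIntegralOfCurves.mass_add_mass_eq`).

Two points need analysis. The first one is that the current of a simple curve is the line integral
along its parametrization, hence changes sign when the curve is reversed and has the difference of
two Dirac masses as its boundary. This follows from the area formula for injective Lipschitz arcs
(`hausdorffMeasure_image_Ioc`): the length of an initial piece is a Lipschitz function of time, whose
derivative is at least the speed because an arc is longer than its chord, and whose increments are
at most the integral of the speed, because the arc is a contraction of its parametrization by the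
integral of the speed.

The second one is that `T₁` and `T₂` are again rectifiable (`IsRectifiable.of_mass_add_eq`). Write
`T = ξ μ` with a unit field `ξ` and `μ = θ ℋ¹` restricted to a rectifiable set. A form that nearly
attains the mass of `T` nearly attains the masses of `T₁` and `T₂` as well, and comparing it with
other forms gives `T₁ ω + T₂ ω' ≤ ∫ g dμ` whenever `ω` and `ω'` are pointwise at most `g`
(`apply_add_apply_le`). Hence `T₁` is bounded on `L²(μ)` and `T₁ = v μ`, by the Riesz representation
theorem, and the same inequality gives `‖v‖ + ‖ξ - v‖ ≤ 1` almost everywhere. By strict convexity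
`v = ρ ξ` with `0 ≤ ρ ≤ 1`. Finally, multiplying the multiplicity by `ρ` does not change the
approximate tangent line at a Lebesgue point of `ρ` (`IsApproxTangentLine.mul_density`).
-/

/-! ### The length of an injective Lipschitz arc -/

theorem LipschitzWith.intervalIntegral_deriv_eq_sub {f : ℝ → ℝ} {K : ℝ≥0} (hf : LipschitzWith K f)
    (a b : ℝ) : ∫ t in a..b, deriv f t = f b - f a :=
  hf.lipschitzOnWith.absolutelyContinuousOnInterval.integral_deriv_eq_sub

theorem LipschitzWith.intervalIntegrable_norm_deriv {d : ℕ} {g : ℝ → E d} {K : ℝ≥0}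
    (hg : LipschitzWith K g) (a b : ℝ) :
    IntervalIntegrable (fun t => ‖deriv g t‖) volume a b := by
  refine (intervalIntegrable_const (c := (K : ℝ))).mono_fun
    (measurable_deriv g).norm.aestronglyMeasurable (ae_of_all _ fun t => ?_)
  simpa using norm_deriv_le_of_lipschitz hg

/-- The mean value inequality in integral form, from the fundamental theorem of calculus for the
real function `t ↦ ⟪u, g t⟫` with `u` the chord. -/
theorem LipschitzWith.norm_sub_le_intervalIntegral_norm_deriv {d : ℕ} {g : ℝ → E d} {K : ℝ≥0}
    (hg : LipschitzWith K g) {s t : ℝ} (hst : s ≤ t) :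
    ‖g t - g s‖ ≤ ∫ x in s..t, ‖deriv g x‖ := by
  set u := g t - g s with hu
  have hL : LipschitzWith (‖innerSL ℝ u‖₊ * K) (fun x => innerSL ℝ u (g x)) :=
    (innerSL ℝ u).lipschitz.comp hg
  have h1 := hL.intervalIntegral_deriv_eq_sub s t
  have h2 : ∫ x in s..t, deriv (fun x => innerSL ℝ u (g x)) x
      ≤ ∫ x in s..t, ‖u‖ * ‖deriv g x‖ := by
    refine intervalIntegral.integral_mono_ae hst
      hL.lipschitzOnWith.absolutelyContinuousOnInterval.intervalIntegrable_deriv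
      ((hg.intervalIntegrable_norm_deriv s t).const_mul _) ?_
    filter_upwards [hg.ae_differentiableAt_real] with x hx
    have := ((innerSL ℝ u).hasFDerivAt.comp_hasDerivAt x hx.hasDerivAt).deriv
    simp only [Function.comp_def] at this
    rw [this]
    exact real_inner_le_norm u (deriv g x)
  rw [h1, intervalIntegral.integral_const_mul] at h2
  have h3 : innerSL ℝ u (g t) - innerSL ℝ u (g s) = ‖u‖ * ‖u‖ := by
    rw [← map_sub, ← hu, innerSL_apply_apply, real_inner_self_eq_norm_mul_norm]
  rw [h3] at h2
  rcases eq_or_lt_of_le (norm_nonneg u) with h0 | h0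
  · rw [← h0]
    exact intervalIntegral.integral_nonneg hst fun _ _ => norm_nonneg _
  · exact le_of_mul_le_mul_left h2 h0

/-- If `g` contracts distances relative to `ℓ`, then `g '' A` is a contraction of `ℓ '' A`, hence
has smaller Hausdorff measure. -/
theorem hausdorffMeasure_image_le_of_edist_le {α X Y : Type*} [EMetricSpace X] [EMetricSpace Y]
    [MeasurableSpace X] [BorelSpace X] [MeasurableSpace Y] [BorelSpace Y] {g : α → X} {ℓ : α → Y}
    {A : Set α} (h : ∀ x ∈ A, ∀ y ∈ A, edist (g x) (g y) ≤ edist (ℓ x) (ℓ y)) :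
    μH[1] (g '' A) ≤ μH[1] (ℓ '' A) := by
  rcases A.eq_empty_or_nonempty with rfl | ⟨a, ha⟩
  · simp
  have : Nonempty α := ⟨a⟩
  set G : Y → X := fun y => g (Function.invFunOn ℓ A y)
  have hinv : ∀ y ∈ ℓ '' A, Function.invFunOn ℓ A y ∈ A ∧ ℓ (Function.invFunOn ℓ A y) = y :=
    fun y hy => ⟨Function.invFunOn_mem hy, Function.invFunOn_eq hy⟩
  have hG : LipschitzOnWith 1 G (ℓ '' A) := by
    intro x hx y hy
    have := h _ (hinv x hx).1 _ (hinv y hy).1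
    rw [(hinv x hx).2, (hinv y hy).2] at this
    simpa using this
  have hsub : g '' A ⊆ G '' (ℓ '' A) := by
    rintro _ ⟨x, hx, rfl⟩
    refine ⟨ℓ x, mem_image_of_mem _ hx, ?_⟩
    have h1 := hinv _ (mem_image_of_mem ℓ hx)
    have := h _ h1.1 _ hx
    rw [h1.2, edist_self] at this
    exact edist_le_zero.1 this
  calc μH[1] (g '' A) ≤ μH[1] (G '' (ℓ '' A)) := measure_mono hsub
    _ ≤ _ := by simpa using hG.hausdorffMeasure_image_le zero_le_one

/-- The integral `ℓ` of the speed maps `[s, t]` onto an interval, and `g` contracts distances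
relative to `ℓ`. -/
theorem hausdorffMeasure_image_Icc_le {d : ℕ} {g : ℝ → E d} {K : ℝ≥0}
    (hg : LipschitzWith K g) (s t : ℝ) :
    μH[1] (g '' Icc s t) ≤ ENNReal.ofReal (∫ x in s..t, ‖deriv g x‖) := by
  set ℓ : ℝ → ℝ := fun x => ∫ y in s..x, ‖deriv g y‖
  have hdiff : ∀ x y, ℓ y - ℓ x = ∫ z in x..y, ‖deriv g z‖ := fun x y =>
    intervalIntegral.integral_interval_sub_left (hg.intervalIntegrable_norm_deriv _ _)
      (hg.intervalIntegrable_norm_deriv _ _)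
  have hmono : Monotone ℓ := fun x y hxy => by
    have := hdiff x y
    have h0 : 0 ≤ ∫ z in x..y, ‖deriv g z‖ :=
      intervalIntegral.integral_nonneg hxy fun _ _ => norm_nonneg _
    linarith
  have key : ∀ x y, dist (g x) (g y) ≤ dist (ℓ x) (ℓ y) := by
    have : ∀ x y, x ≤ y → dist (g x) (g y) ≤ dist (ℓ x) (ℓ y) := fun x y hxy => by
      rw [dist_comm, dist_eq_norm, dist_comm, Real.dist_eq, hdiff]
      exact (hg.norm_sub_le_intervalIntegral_norm_deriv hxy).trans (le_abs_self _)
    intro x y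
    rcases le_total x y with h | h
    · exact this x y h
    · rw [dist_comm, dist_comm (ℓ x)]; exact this y x h
  calc μH[1] (g '' Icc s t) ≤ μH[1] (ℓ '' Icc s t) :=
        hausdorffMeasure_image_le_of_edist_le fun x _ y _ => by
          rw [edist_dist, edist_dist]; exact ENNReal.ofReal_le_ofReal (key x y)
    _ ≤ μH[1] (Icc (ℓ s) (ℓ t)) := measure_mono (by
        rintro _ ⟨x, hx, rfl⟩
        exact ⟨hmono hx.1, hmono hx.2⟩)
    _ = _ := by
        rw [hausdorffMeasure_real, Real.volume_Icc, hdiff]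

/-- A continuous image of an interval is at least as long as its chord, since it is mapped onto a
segment of that length by the distance to one end point. -/
theorem edist_le_hausdorffMeasure_image_Icc {d : ℕ} {g : ℝ → E d} (hg : Continuous g) {s t : ℝ}
    (hst : s ≤ t) : edist (g s) (g t) ≤ μH[1] (g '' Icc s t) := by
  have h1 : μH[1] ((fun z => dist (g s) z) '' (g '' Icc s t)) ≤ μH[1] (g '' Icc s t) := by
    simpa using (LipschitzWith.dist_right (g s)).hausdorffMeasure_image_le zero_le_one
      (g '' Icc s t)
  refine le_trans ?_ h1
  have h2 : Icc 0 (dist (g s) (g t)) ⊆ (fun z => dist (g s) z) '' (g '' Icc s t) := by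
    rw [image_image]
    have := intermediate_value_Icc hst (f := fun x => dist (g s) (g x)) (by fun_prop)
    simpa using this
  refine le_trans ?_ (measure_mono h2)
  rw [hausdorffMeasure_real, Real.volume_Icc, sub_zero, edist_dist]

theorem hausdorffMeasure_image_le_volume {d : ℕ} {g : ℝ → E d} (hg : LipschitzWith 1 g)
    (A : Set ℝ) : μH[1] (g '' A) ≤ volume A := by
  rw [← hausdorffMeasure_real]
  simpa using hg.hausdorffMeasure_image_le zero_le_one A

/-- The length of an injective Lipschitz arc is the integral of its speed. The length of the part
up to time `x` is a Lipschitz function of `x`; its derivative is at least the speed, because arcs are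
longer than chords. -/
theorem hausdorffMeasure_image_Ioc {d : ℕ} {g : ℝ → E d} (hg : LipschitzWith 1 g) {p q : ℝ}
    (hinj : InjOn g (Ioc p q)) {s t : ℝ} (hps : p ≤ s) (hst : s ≤ t) (htq : t ≤ q) :
    μH[1] (g '' Ioc s t) = ENNReal.ofReal (∫ x in s..t, ‖deriv g x‖) := by
  have hIcc : ∀ s t : ℝ, s ≤ t → μH[1] (g '' Icc s t) = μH[1] (g '' Ioc s t) := fun s t h => by
    rw [← Ioc_insert_left h, image_insert_eq]
    have := Measure.nullSingletonClass_hausdorff (E d) one_pos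
    exact measure_congr (insert_ae_eq_self _ _)
  refine le_antisymm ((measure_mono (image_mono Ioc_subset_Icc_self)).trans
    (hausdorffMeasure_image_Icc_le hg s t)) ?_
  set L : ℝ → ℝ := fun x => (μH[1] (g '' (Ioc p q ∩ Iic x))).toReal with hL
  have hfin : ∀ A ⊆ Ioc p q, μH[1] (g '' A) ≠ ∞ := fun A hA =>
    ((hausdorffMeasure_image_le_volume hg A).trans_lt
      ((measure_mono hA).trans_lt measure_Ioc_lt_top)).ne
  have hmeas : ∀ x y : ℝ, MeasurableSet (g '' (Ioc p q ∩ Ioc x y)) := fun x y =>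
    (measurableSet_Ioc.inter measurableSet_Ioc).image_of_continuousOn_injOn
      hg.continuous.continuousOn (hinj.mono inter_subset_left)
  have hsub : ∀ x y, x ≤ y → L y - L x = (μH[1] (g '' (Ioc p q ∩ Ioc x y))).toReal := by
    intro x y hxy
    have hU : Ioc p q ∩ Iic y = (Ioc p q ∩ Iic x) ∪ (Ioc p q ∩ Ioc x y) := by
      rw [← inter_union_distrib_left, Iic_union_Ioc_eq_Iic hxy]
    have hdisj : Disjoint (g '' (Ioc p q ∩ Iic x)) (g '' (Ioc p q ∩ Ioc x y)) := by
      refine Set.disjoint_left.2 ?_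
      rintro _ ⟨z, hz, rfl⟩ ⟨w, hw, hwz⟩
      rw [hinj hw.1 hz.1 hwz] at hw
      exact not_lt.2 hz.2 hw.2.1
    simp only [hL]
    rw [hU, image_union, measure_union hdisj (hmeas x y),
      ENNReal.toReal_add (hfin _ inter_subset_left) (hfin _ inter_subset_left)]
    ring
  have hLip : LipschitzWith 1 L := by
    refine LipschitzWith.of_le_add fun x y => ?_
    rcases le_total x y with h | h
    · have := hsub x y h
      have h0 : 0 ≤ (μH[1] (g '' (Ioc p q ∩ Ioc x y))).toReal := ENNReal.toReal_nonneg
      linarith [dist_nonneg (x := x) (y := y)]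
    · have h1 := hsub y x h
      have h2 : (μH[1] (g '' (Ioc p q ∩ Ioc y x))).toReal ≤ x - y := by
        refine ENNReal.toReal_le_of_le_ofReal (sub_nonneg.2 h) ?_
        rw [← Real.volume_Ioc]
        exact (hausdorffMeasure_image_le_volume hg _).trans (measure_mono inter_subset_right)
      rw [Real.dist_eq, abs_of_nonneg (sub_nonneg.2 h)]
      linarith
  have hderiv : ∀ᵐ x, x ∈ Ioc s t → ‖deriv g x‖ ≤ deriv L x := by
    have hne : ∀ᵐ x : ℝ, x ≠ q := by simp [ae_iff]
    filter_upwards [hg.ae_differentiableAt_real, hLip.ae_differentiableAt_real, hne]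
      with x hx1 hx2 hxq hx
    have e1 := (hx1.hasDerivAt.tendsto_slope_zero_right).norm
    have e2 := hx2.hasDerivAt.tendsto_slope_zero_right
    refine le_of_tendsto_of_tendsto e1 e2 ?_
    have hlt : 0 < q - x := sub_pos.2 (lt_of_le_of_ne (hx.2.trans htq) hxq)
    filter_upwards [Ioo_mem_nhdsGT hlt] with h hh
    rw [norm_smul, Real.norm_of_nonneg (inv_nonneg.2 hh.1.le), smul_eq_mul,
      hsub x (x + h) (by linarith [hh.1])]
    refine mul_le_mul_of_nonneg_left ?_ (inv_nonneg.2 hh.1.le)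
    have hset : Ioc p q ∩ Ioc x (x + h) = Ioc x (x + h) :=
      inter_eq_right.2 (Ioc_subset_Ioc (hps.trans hx.1.le) (by linarith [hh.2]))
    rw [hset, ← hIcc _ _ (by linarith [hh.1]), ← dist_eq_norm, dist_comm, dist_edist]
    refine ENNReal.toReal_mono ?_
      (edist_le_hausdorffMeasure_image_Icc hg.continuous (by linarith [hh.1]))
    rw [hIcc _ _ (by linarith [hh.1]), ← hset]
    exact hfin _ inter_subset_left
  have hint : ∫ x in s..t, ‖deriv g x‖ ≤ ∫ x in s..t, deriv L x := by
    rw [intervalIntegral.integral_of_le hst, intervalIntegral.integral_of_le hst]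
    refine setIntegral_mono_on_ae (hg.intervalIntegrable_norm_deriv s t).1
      (hLip.lipschitzOnWith.absolutelyContinuousOnInterval.intervalIntegrable_deriv).1
      measurableSet_Ioc hderiv
  rw [hLip.intervalIntegral_deriv_eq_sub, hsub s t hst,
    inter_eq_right.2 (Ioc_subset_Ioc hps htq)] at hint
  exact ENNReal.ofReal_le_of_le_toReal hint

/-- The area formula for an injective Lipschitz arc. No measurability of the integrand is needed:
both sides are integrals against the same measure, transported by the arc. -/
theorem setIntegral_hausdorffMeasure_image_Ioc {d : ℕ} {g : ℝ → E d} (hg : LipschitzWith 1 g)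
    {p q : ℝ} (hinj : InjOn g (Ioc p q)) (f : E d → ℝ) :
    ∫ z in g '' Ioc p q, f z ∂μH[1] = ∫ t in Ioc p q, ‖deriv g t‖ * f (g t) := by
  set G : Ioc p q → E d := (Ioc p q).domRestrict g
  have hG : MeasurableEmbedding G :=
    hg.continuous.continuousOn.measurableEmbedding measurableSet_Ioc hinj
  have hval : MeasurableEmbedding (Subtype.val : Ioc p q → ℝ) :=
    MeasurableEmbedding.subtype_coe measurableSet_Ioc
  have hcm : Measurable fun t => ‖deriv g t‖ₑ := (measurable_deriv g).enorm
  have key : (Measure.comap G μH[1]).map Subtype.val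
      = (volume.restrict (Ioc p q)).withDensity fun t => ‖deriv g t‖ₑ := by
    have hap : ∀ A, MeasurableSet A → (Measure.comap G μH[1]).map Subtype.val A
        = μH[1] (g '' (Ioc p q ∩ A)) := fun A hA => by
      rw [Measure.map_apply measurable_subtype_coe hA, hG.comap_apply]
      congr 1
      ext z
      simp only [G, mem_image, mem_preimage, Subtype.exists, domRestrict_apply, mem_inter_iff]
      grind
    have hI : ∀ a b, (Measure.comap G μH[1]).map Subtype.val (Ioc a b)
      = (volume.restrict (Ioc p q)).withDensity (fun t => ‖deriv g t‖ₑ) (Ioc a b) := by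
      intro a b
      rw [hap _ measurableSet_Ioc, withDensity_apply _ measurableSet_Ioc,
        Measure.restrict_restrict measurableSet_Ioc, inter_comm, Ioc_inter_Ioc]
      rcases le_total (max a p) (min b q) with h | h
      · rw [hausdorffMeasure_image_Ioc hg hinj (le_max_right _ _) h (min_le_right _ _),
          intervalIntegral.integral_of_le h, ofReal_integral_eq_lintegral_ofReal
            (hg.intervalIntegrable_norm_deriv _ _).1 (ae_of_all _ fun _ => norm_nonneg _)]
        simp_rw [ofReal_norm]
      · simp [Ioc_eq_empty (not_lt.2 h)]
    refine Measure.ext_of_Ioc' _ _ (fun a b _ => ?_) fun a b _ => hI a b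
    rw [hap _ measurableSet_Ioc]
    exact ((hausdorffMeasure_image_le_volume hg _).trans_lt
      ((measure_mono inter_subset_left).trans_lt measure_Ioc_lt_top)).ne
  have hr : range G = g '' Ioc p q := by simp [G, range_domRestrict]
  rw [← hr, ← hG.map_comap, hG.integral_map]
  have h2 : ∫ x : Ioc p q, f (G x) ∂(Measure.comap G μH[1])
      = ∫ t, f (g t) ∂((Measure.comap G μH[1]).map Subtype.val) := by
    rw [hval.integral_map]; rfl
  rw [h2, key, integral_withDensity_eq_integral_toReal_smul hcm (by simp)]
  simp

/-! ### The current of a simple curve -/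

namespace TransportPaths

theorem extDeriv0_apply {d : ℕ} (f : Form0 d) (z : E d) : extDeriv0 f z = fderiv ℝ f z := by
  simp [extDeriv0]

namespace Curve

variable {d : ℕ}

/-- The infimum defining `tStop` is attained. -/
theorem eval_eq_of_tStop_le (γ : Curve d) {s : ℝ≥0} (hs : γ.tStop ≤ s) : γ s = γ γ.tStop := by
  have hne : {t | ∀ s, t ≤ s → γ s = γ t}.Nonempty := γ.2.2
  have h1 : ∀ s u, γ.tStop < s → γ.tStop < u → γ s = γ u := by
    intro s u hs hu
    obtain ⟨t, ht, htlt⟩ := exists_lt_of_csInf_lt hne (lt_min hs hu)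
    rw [ht s (htlt.le.trans (min_le_left _ _)), ht u (htlt.le.trans (min_le_right _ _))]
  rcases hs.eq_or_lt with rfl | hlt
  · rfl
  have hcl : IsClosed {u | γ s = γ u} := isClosed_eq continuous_const γ.1.continuous
  have : closure (Ioi γ.tStop) ⊆ {u | γ s = γ u} := hcl.closure_subset_iff.2 fun u hu => h1 s u hlt hu
  rw [closure_Ioi] at this
  exact this self_mem_Ici

theorem tStop_le_iff (γ : Curve d) (t : ℝ≥0) : γ.tStop ≤ t ↔ ∀ s, t ≤ s → γ s = γ t := by
  refine ⟨fun h s hs => ?_, fun h => csInf_le (OrderBot.bddBelow _) h⟩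
  rw [γ.eval_eq_of_tStop_le (h.trans hs), γ.eval_eq_of_tStop_le h]

theorem IsNonconstant.bddAbove {γ : Curve d} (h : γ.IsNonconstant) :
    BddAbove {t | ∀ s, s ≤ t → γ s = γ 0} := by
  obtain ⟨s, u, hsu⟩ := h
  refine ⟨max s u, fun t ht => ?_⟩
  by_contra! hlt
  exact hsu ((ht s ((le_max_left _ _).trans hlt.le)).trans
    (ht u ((le_max_right _ _).trans hlt.le)).symm)

/-- The supremum defining `t₀` is attained, unless the curve is constant. -/
theorem IsNonconstant.le_t₀_iff {γ : Curve d} (h : γ.IsNonconstant) (t : ℝ≥0) :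
    t ≤ γ.t₀ ↔ ∀ s, s ≤ t → γ s = γ 0 := by
  refine ⟨fun ht s hs => ?_, fun ht => le_csSup h.bddAbove ht⟩
  have h1 : ∀ s, s < γ.t₀ → γ s = γ 0 := fun s hs => by
    obtain ⟨u, hu, hsu⟩ := exists_lt_of_lt_csSup (s := {t | ∀ s, s ≤ t → γ s = γ 0})
      ⟨0, fun s hs => by rw [nonpos_iff_eq_zero.1 hs]⟩ hs
    exact hu s hsu.le
  rcases (hs.trans ht).eq_or_lt with rfl | hlt
  · by_cases h0 : γ.t₀ = 0
    · rw [h0]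
    have hcl : IsClosed {u | γ u = γ 0} := isClosed_eq γ.1.continuous continuous_const
    have : closure (Iio γ.t₀) ⊆ {u | γ u = γ 0} := hcl.closure_subset_iff.2 fun u hu => h1 u hu
    rw [closure_Iio' ⟨0, pos_iff_ne_zero.2 h0⟩] at this
    exact this self_mem_Iic
  · exact h1 s hlt

theorem IsNonconstant.eval_eq_of_le_t₀ {γ : Curve d} (h : γ.IsNonconstant) {s : ℝ≥0}
    (hs : s ≤ γ.t₀) : γ s = γ 0 :=
  (h.le_t₀_iff s).1 hs s le_rfl

theorem IsNonconstant.t₀_lt_tStop {γ : Curve d} (h : γ.IsNonconstant) : γ.t₀ < γ.tStop := by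
  by_contra! hle
  obtain ⟨s, u, hsu⟩ := h
  have h0 : γ γ.tStop = γ 0 := IsNonconstant.eval_eq_of_le_t₀ ⟨s, u, hsu⟩ hle
  have : ∀ v, γ v = γ 0 := fun v => by
    rcases le_total v γ.t₀ with hv | hv
    · exact IsNonconstant.eval_eq_of_le_t₀ ⟨s, u, hsu⟩ hv
    · rw [γ.eval_eq_of_tStop_le (hle.trans hv), h0]
  exact hsu ((this s).trans (this u).symm)

theorem endPoint_eq (γ : Curve d) : γ.endPoint = γ γ.tStop := by
  refine tendsto_nhds_unique γ.tendsto_endPoint (tendsto_const_nhds.congr' ?_)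
  filter_upwards [eventually_ge_atTop γ.tStop] with s hs using (γ.eval_eq_of_tStop_le hs).symm

/-- A curve, extended to negative times by its starting point. -/
def extend (γ : Curve d) (s : ℝ) : E d := γ s.toNNReal

theorem extend_coe (γ : Curve d) (s : ℝ≥0) : γ.extend s = γ s := by simp [extend]

theorem lipschitzWith_extend (γ : Curve d) : LipschitzWith 1 γ.extend := by
  have h : LipschitzWith 1 Real.toNNReal := lipschitzWith_posPart
  have := γ.2.1.comp h
  rwa [one_mul] at this

theorem continuous_extend (γ : Curve d) : Continuous γ.extend := γ.lipschitzWith_extend.continuous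

theorem IsSimple.injOn_extend {γ : Curve d} (hs : γ.IsSimple) :
    InjOn γ.extend (Icc (γ.t₀ : ℝ) γ.tStop) := by
  have key : ∀ x y : ℝ, (γ.t₀ : ℝ) ≤ x → x < y → y ≤ γ.tStop → γ.extend x ≠ γ.extend y := by
    intro x y hx hxy hy
    have hx0 : 0 ≤ x := γ.t₀.coe_nonneg.trans hx
    lift y to ℝ≥0 using hx0.trans hxy.le
    lift x to ℝ≥0 using hx0
    rw [extend_coe, extend_coe]
    exact hs x y (by exact_mod_cast hx) (by exact_mod_cast hxy) (by exact_mod_cast hy)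
  intro x hx y hy hxy
  rcases lt_trichotomy x y with h | h | h
  · exact absurd hxy (key x y hx.1 h hy.2)
  · exact h
  · exact absurd hxy.symm (key y x hy.1 h hx.2)

/-- The first time at which a simple curve is at `γ t` is `t` itself. The initial point is excluded,
as the curve may rest there. -/
theorem IsSimple.unitTangent_eval {γ : Curve d} (hs : γ.IsSimple) (hn : γ.IsNonconstant)
    {t : ℝ} (ht : t ∈ Ioc (γ.t₀ : ℝ) γ.tStop) :
    γ.unitTangent (γ.extend t) = ‖deriv γ.extend t‖⁻¹ • deriv γ.extend t := by
  lift t to ℝ≥0 using γ.t₀.coe_nonneg.trans ht.1.le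
  have ht1 : γ.t₀ < t := by exact_mod_cast ht.1
  have ht2 : t ≤ γ.tStop := by exact_mod_cast ht.2
  have hleast : IsLeast {u : ℝ≥0 | γ u = γ.extend t} t := by
    refine ⟨(extend_coe γ t).symm, fun u hu => ?_⟩
    rw [mem_ofPred_eq, extend_coe] at hu
    by_contra! hlt
    rcases le_total γ.t₀ u with h | h
    · exact hs u t h hlt ht2 hu
    · refine hs γ.t₀ t le_rfl ht1 ht2 ?_
      rw [← hu, hn.eval_eq_of_le_t₀ h, hn.eval_eq_of_le_t₀ le_rfl]
  simp only [unitTangent]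
  rw [hleast.csInf_eq]
  rfl

theorem IsNonconstant.range_eq {γ : Curve d} (hn : γ.IsNonconstant) :
    range γ = insert (γ γ.t₀) (γ.extend '' Ioc (γ.t₀ : ℝ) γ.tStop) := by
  apply Subset.antisymm
  · rintro _ ⟨t, rfl⟩
    rcases le_or_gt t γ.t₀ with h | h
    · left; rw [hn.eval_eq_of_le_t₀ h, hn.eval_eq_of_le_t₀ le_rfl]
    · right
      rcases le_total t γ.tStop with h' | h'
      · exact ⟨t, ⟨by exact_mod_cast h, by exact_mod_cast h'⟩, extend_coe γ t⟩
      · refine ⟨γ.tStop, ⟨by exact_mod_cast hn.t₀_lt_tStop, le_rfl⟩, ?_⟩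
        rw [extend_coe, γ.eval_eq_of_tStop_le h']
  · refine insert_subset (mem_range_self _) ?_
    rintro _ ⟨t, -, rfl⟩
    exact mem_range_self _

/-- The current of a simple curve is the line integral along its parametrization. -/
theorem IsSimple.toFunctional_eq {γ : Curve d} (hs : γ.IsSimple) (hn : γ.IsNonconstant)
    (ω : Form1 d) :
    γ.toFunctional ω
      = ∫ t in (γ.t₀ : ℝ)..γ.tStop, ω (γ.extend t) (deriv γ.extend t) := by
  have hle : (γ.t₀ : ℝ) ≤ γ.tStop := by exact_mod_cast hn.t₀_lt_tStop.le
  have := Measure.nullSingletonClass_hausdorff (E d) one_pos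
  unfold toFunctional tauFunctional
  rw [hn.range_eq, setIntegral_congr_set (insert_ae_eq_self _ _),
    setIntegral_hausdorffMeasure_image_Ioc γ.lipschitzWith_extend
      (hs.injOn_extend.mono Ioc_subset_Icc_self), intervalIntegral.integral_of_le hle]
  refine setIntegral_congr_fun measurableSet_Ioc fun t ht => ?_
  simp only [mul_one]
  rw [hs.unitTangent_eval hn ht, map_smul, smul_eq_mul]
  by_cases h0 : deriv γ.extend t = 0
  · simp [h0]
  · rw [mul_inv_cancel_left₀ (norm_ne_zero_iff.2 h0)]

theorem intervalIntegrable_lineIntegrand (γ : Curve d) (ω : Form1 d) (a b : ℝ) :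
    IntervalIntegrable (fun t => ω (γ.extend t) (deriv γ.extend t)) volume a b := by
  obtain ⟨C, hC⟩ := ω.hasCompactSupport.exists_bound_of_continuous ω.continuous
  refine (intervalIntegrable_const (c := C)).mono_fun ?_ (ae_of_all _ fun t => ?_)
  · have h1 : Continuous fun t => ω (γ.extend t) := ω.continuous.comp γ.continuous_extend
    have h2 : StronglyMeasurable (deriv γ.extend) := (measurable_deriv _).stronglyMeasurable
    exact ((continuous_fst.clm_apply continuous_snd).comp_stronglyMeasurable
      (h1.stronglyMeasurable.prodMk h2)).aestronglyMeasurable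
  · have h1 : ‖deriv γ.extend t‖ ≤ 1 := by
      simpa using norm_deriv_le_of_lipschitz γ.lipschitzWith_extend
    calc ‖ω (γ.extend t) (deriv γ.extend t)‖ ≤ ‖ω (γ.extend t)‖ * ‖deriv γ.extend t‖ :=
          (ω (γ.extend t)).le_opNorm _
      _ ≤ C * 1 := mul_le_mul (hC _) h1 (norm_nonneg _) ((norm_nonneg _).trans (hC 0))
      _ ≤ ‖C‖ := by rw [mul_one]; exact le_abs_self C

theorem IsSimple.toFunctional_add {γ : Curve d} (hs : γ.IsSimple) (hn : γ.IsNonconstant)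
    (ω ω' : Form1 d) :
    γ.toFunctional (ω + ω') = γ.toFunctional ω + γ.toFunctional ω' := by
  rw [hs.toFunctional_eq hn, hs.toFunctional_eq hn, hs.toFunctional_eq hn,
    ← intervalIntegral.integral_add (γ.intervalIntegrable_lineIntegrand _ _ _)
      (γ.intervalIntegrable_lineIntegrand _ _ _)]
  rfl

theorem toFunctional_smul (γ : Curve d) (c : ℝ) (ω : Form1 d) :
    γ.toFunctional (c • ω) = c * γ.toFunctional ω := by
  unfold toFunctional tauFunctional
  rw [← integral_const_mul]
  congr 1
  ext z
  change c * ω z _ * 1 = _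
  ring

/-- The boundary of the current of a simple curve from `p` to `q` is `δ_q - δ_p`. -/
theorem IsSimple.boundary_toFunctional {γ : Curve d} (hs : γ.IsSimple) (hn : γ.IsNonconstant)
    (f : Form0 d) :
    boundary γ.toFunctional f = f γ.endPoint - f γ.startPoint := by
  unfold boundary
  rw [hs.toFunctional_eq hn]
  have hf : ContDiff ℝ 1 f := f.contDiff.of_le (by simp)
  obtain ⟨C, hC⟩ := hf.lipschitzWith_of_hasCompactSupport f.hasCompactSupport one_ne_zero
  have hL : LipschitzWith (C * 1) (fun t => f (γ.extend t)) := hC.comp γ.lipschitzWith_extend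
  have h1 := hL.intervalIntegral_deriv_eq_sub γ.t₀ γ.tStop
  rw [extend_coe, extend_coe, hn.eval_eq_of_le_t₀ le_rfl, ← endPoint_eq] at h1
  refine Eq.trans ?_ h1
  refine intervalIntegral.integral_congr_ae ?_
  filter_upwards [γ.lipschitzWith_extend.ae_differentiableAt_real] with t ht _
  rw [extDeriv0_apply]
  have hd : DifferentiableAt ℝ f (γ.extend t) := hf.differentiable one_ne_zero _
  exact (hd.hasFDerivAt.comp_hasDerivAt t ht.hasDerivAt).deriv.symm

end Curve
end TransportPaths

/-! ### Reversal of curves -/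

namespace TransportPaths
namespace Curve

variable {d : ℕ}

instance : SecondCountableTopology (Curve d) :=
  (Topology.IsEmbedding.subtypeVal :
    IsEmbedding (Subtype.val : Curve d → C(ℝ≥0, E d))).secondCountableTopology

theorem continuous_eval (t : ℝ≥0) : Continuous fun γ : Curve d => γ t :=
  (continuous_eval_const (F := C(ℝ≥0, E d)) t).comp continuous_subtype_val

theorem ext_eval {γ γ' : Curve d} (h : ∀ t, γ t = γ' t) : γ = γ' :=
  Subtype.ext (ContinuousMap.ext h)

/-- The curve that runs through `γ` backwards from time `c`. -/
noncomputable def backwardsFrom (p : Curve d × ℝ≥0) : Curve d :=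
  ⟨⟨fun t => p.1 (p.2 - t), by have := p.1.1.continuous; fun_prop⟩, by
    have h : LipschitzWith 1 fun t : ℝ≥0 => p.2 - t := LipschitzWith.of_dist_le_mul fun x y => by
      rw [NNReal.dist_eq, NNReal.dist_eq, NNReal.coe_one, one_mul, NNReal.coe_sub_def,
        NNReal.coe_sub_def, abs_sub_comm (x : ℝ)]
      refine (abs_max_sub_max_le_abs _ _ 0).trans (le_of_eq ?_)
      congr 1
      ring
    have := p.1.2.1.comp h
    rwa [one_mul] at this, p.2, fun s hs => by simp [tsub_eq_zero_of_le hs]⟩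

theorem continuous_backwardsFrom : Continuous (backwardsFrom : Curve d × ℝ≥0 → Curve d) := by
  refine Continuous.subtype_mk (ContinuousMap.continuous_of_continuous_uncurry _ ?_) _
  have h : Continuous fun q : (Curve d × ℝ≥0) × ℝ≥0 => (q.1.1.1, q.1.2 - q.2) :=
    (continuous_subtype_val.comp (continuous_fst.comp continuous_fst)).prodMk
      ((continuous_snd.comp continuous_fst).sub continuous_snd)
  exact (ContinuousEval.continuous_eval (F := C(ℝ≥0, E d))).comp h

theorem measurable_tStop : Measurable (tStop : Curve d → ℝ≥0) := by
  refine measurable_of_Iic fun t => IsClosed.measurableSet ?_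
  have : tStop ⁻¹' Iic t = ⋂ (s : ℝ≥0) (_ : t ≤ s), {γ : Curve d | γ s = γ t} := by
    ext γ
    simp [tStop_le_iff]
  rw [this]
  exact isClosed_biInter fun s _ => isClosed_eq (continuous_eval s) (continuous_eval t)

theorem measurableSet_isNonconstant : MeasurableSet {γ : Curve d | γ.IsNonconstant} := by
  have : {γ : Curve d | γ.IsNonconstant} = ⋃ (s : ℝ≥0) (t : ℝ≥0), {γ : Curve d | γ s ≠ γ t} := by
    ext γ
    simp [IsNonconstant]
  rw [this]
  exact (isOpen_iUnion fun s => isOpen_iUnion fun t =>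
    isOpen_ne_fun (continuous_eval s) (continuous_eval t)).measurableSet

theorem t₀_eq_zero_of_not_isNonconstant {γ : Curve d} (h : ¬ γ.IsNonconstant) : γ.t₀ = 0 := by
  have : {t | ∀ s, s ≤ t → γ s = γ 0} = univ := by
    simp only [IsNonconstant, not_exists, not_not] at h
    exact eq_univ_of_forall fun t s _ => h s 0
  rw [t₀, this, NNReal.sSup_of_not_bddAbove not_bddAbove_univ]

theorem measurable_t₀ : Measurable (t₀ : Curve d → ℝ≥0) := by
  refine measurable_of_Ici fun t => ?_
  rcases eq_or_ne t 0 with rfl | ht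
  · simp
  have : t₀ ⁻¹' Ici t = {γ : Curve d | γ.IsNonconstant} ∩
      ⋂ (s : ℝ≥0) (_ : s ≤ t), {γ : Curve d | γ s = γ 0} := by
    ext γ
    by_cases h : γ.IsNonconstant
    · simp [h, h.le_t₀_iff]
    · simp [h, t₀_eq_zero_of_not_isNonconstant h, ht]
  rw [this]
  exact measurableSet_isNonconstant.inter (isClosed_biInter fun s _ =>
    isClosed_eq (continuous_eval s) (continuous_eval 0)).measurableSet

/-- The reversed curve. It rests initially for the same time as `γ`, and stops at the same time, so
that reversal is an involution. -/
noncomputable def reverse (γ : Curve d) : Curve d := backwardsFrom (γ, γ.t₀ + γ.tStop)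

theorem reverse_apply (γ : Curve d) (t : ℝ≥0) : γ.reverse t = γ (γ.t₀ + γ.tStop - t) := rfl

theorem measurable_reverse : Measurable (reverse : Curve d → Curve d) :=
  continuous_backwardsFrom.measurable.comp
    (measurable_id.prodMk (measurable_t₀.add measurable_tStop))

theorem reverse_isNonconstant_iff (γ : Curve d) : γ.reverse.IsNonconstant ↔ γ.IsNonconstant := by
  refine ⟨fun ⟨s, t, h⟩ => ⟨_, _, h⟩, fun ⟨s, t, h⟩ => ?_⟩
  have key : ∀ u, γ.reverse (γ.t₀ + γ.tStop - min u (γ.t₀ + γ.tStop)) = γ u := fun u => by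
    rw [reverse_apply, tsub_tsub_cancel_of_le (min_le_right _ _)]
    rcases le_total u (γ.t₀ + γ.tStop) with hu | hu
    · rw [min_eq_left hu]
    · rw [min_eq_right hu, γ.eval_eq_of_tStop_le le_add_self,
        γ.eval_eq_of_tStop_le (le_add_self.trans hu)]
  exact ⟨_, _, fun heq => h ((key s).symm.trans (heq.trans (key t)))⟩

theorem IsNonconstant.t₀_reverse {γ : Curve d} (hn : γ.IsNonconstant) : γ.reverse.t₀ = γ.t₀ := by
  have hr := (reverse_isNonconstant_iff γ).2 hn
  apply le_antisymm
  · by_contra! hlt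
    have h1 : ∀ s, s ≤ γ.reverse.t₀ → γ (γ.t₀ + γ.tStop - s) = γ γ.tStop := fun s hs => by
      have := hr.eval_eq_of_le_t₀ hs
      rwa [reverse_apply, reverse_apply, tsub_zero, γ.eval_eq_of_tStop_le le_add_self] at this
    have h2 : γ.tStop ≤ γ.t₀ + γ.tStop - γ.reverse.t₀ := by
      refine (γ.tStop_le_iff _).2 fun s hs => ?_
      rw [h1 _ le_rfl]
      rcases le_total s (γ.t₀ + γ.tStop) with h | h
      · rw [← h1 (γ.t₀ + γ.tStop - s) (by
            rw [tsub_le_iff_left] at hs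
            rwa [tsub_le_iff_right]),
          tsub_tsub_cancel_of_le h]
      · exact γ.eval_eq_of_tStop_le (le_add_self.trans h)
    have h3 : γ.t₀ + γ.tStop - γ.reverse.t₀ < γ.tStop := by
      rcases le_total γ.reverse.t₀ (γ.t₀ + γ.tStop) with h | h
      · rw [tsub_lt_iff_left h]
        gcongr
      · rw [tsub_eq_zero_of_le h]
        exact zero_le.trans_lt hn.t₀_lt_tStop
    exact h2.not_gt h3
  · refine (hr.le_t₀_iff _).2 fun s hs => ?_
    rw [reverse_apply, reverse_apply, tsub_zero, γ.eval_eq_of_tStop_le le_add_self,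
      γ.eval_eq_of_tStop_le]
    rw [add_comm, add_tsub_assoc_of_le hs]
    exact le_self_add

theorem IsNonconstant.tStop_reverse {γ : Curve d} (hn : γ.IsNonconstant) :
    γ.reverse.tStop = γ.tStop := by
  apply le_antisymm
  · refine (tStop_le_iff _ _).2 fun s hs => ?_
    rw [reverse_apply, reverse_apply, add_tsub_cancel_right, hn.eval_eq_of_le_t₀ le_rfl,
      hn.eval_eq_of_le_t₀]
    rw [tsub_le_iff_right]
    gcongr
  · by_contra! hlt
    have h1 : γ.t₀ + γ.tStop - γ.reverse.tStop ≤ γ.t₀ := by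
      refine (hn.le_t₀_iff _).2 fun s hs => ?_
      have hs' : γ.reverse.tStop ≤ γ.t₀ + γ.tStop - s := by
        have := tsub_le_tsub_left hs (γ.t₀ + γ.tStop)
        rwa [tsub_tsub_cancel_of_le (hlt.le.trans le_add_self)] at this
      have h2 := γ.reverse.eval_eq_of_tStop_le hs'
      have h3 := γ.reverse.eval_eq_of_tStop_le (s := γ.t₀ + γ.tStop) (hs'.trans tsub_le_self)
      rw [← h3, reverse_apply, reverse_apply, tsub_self,
        tsub_tsub_cancel_of_le (hs.trans tsub_le_self)] at h2
      exact h2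
    rw [tsub_le_iff_left] at h1
    have h2 : γ.reverse.tStop + γ.t₀ < γ.tStop + γ.t₀ := by gcongr
    rw [add_comm γ.tStop] at h2
    exact h1.not_gt h2

theorem reverse_reverse (γ : Curve d) : γ.reverse.reverse = γ := by
  refine ext_eval fun t => ?_
  by_cases hn : γ.IsNonconstant
  · rw [reverse_apply, hn.t₀_reverse, hn.tStop_reverse, reverse_apply]
    rcases le_total t (γ.t₀ + γ.tStop) with h | h
    · rw [tsub_tsub_cancel_of_le h]
    · rw [tsub_eq_zero_of_le h, tsub_zero, γ.eval_eq_of_tStop_le le_add_self,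
        γ.eval_eq_of_tStop_le (le_add_self.trans h)]
  · simp only [IsNonconstant, not_exists, not_not] at hn
    exact hn _ _

/-- Reversal, as a Borel automorphism of the space of curves. -/
noncomputable def reverseEquiv : Curve d ≃ᵐ Curve d where
  toFun := reverse
  invFun := reverse
  left_inv := reverse_reverse
  right_inv := reverse_reverse
  measurable_toFun := measurable_reverse
  measurable_invFun := measurable_reverse

theorem startPoint_reverse (γ : Curve d) : γ.reverse.startPoint = γ.endPoint := by
  rw [startPoint, reverse_apply, tsub_zero, γ.eval_eq_of_tStop_le le_add_self, endPoint_eq]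

theorem endPoint_reverse (γ : Curve d) : γ.reverse.endPoint = γ.startPoint := by
  rw [← startPoint_reverse, reverse_reverse]

theorem IsSimple.reverse {γ : Curve d} (hs : γ.IsSimple) (hn : γ.IsNonconstant) :
    γ.reverse.IsSimple := by
  intro s t h1 h2 h3
  rw [hn.t₀_reverse] at h1
  rw [hn.tStop_reverse] at h3
  rw [reverse_apply, reverse_apply]
  have h4 : γ.t₀ + γ.tStop - t < γ.t₀ + γ.tStop - s :=
    tsub_lt_tsub_left_of_le (h3.trans le_add_self) h2
  refine (hs _ _ ?_ h4 ?_).symm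
  · rw [add_tsub_assoc_of_le h3]; exact le_self_add
  · rw [tsub_le_iff_left]; gcongr

theorem extend_reverse (γ : Curve d) {t : ℝ} (ht : 0 ≤ t) :
    γ.reverse.extend t = γ.extend (γ.t₀ + γ.tStop - t) := by
  lift t to ℝ≥0 using ht
  rw [extend_coe, reverse_apply, extend]
  congr 1

/-- Reversing a simple curve reverses the sign of its current. -/
theorem IsSimple.toFunctional_reverse {γ : Curve d} (hs : γ.IsSimple) (hn : γ.IsNonconstant)
    (ω : Form1 d) : γ.reverse.toFunctional ω = - γ.toFunctional ω := by
  have hle : (γ.t₀ : ℝ) ≤ γ.tStop := by exact_mod_cast hn.t₀_lt_tStop.le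
  rw [(hs.reverse hn).toFunctional_eq ((reverse_isNonconstant_iff γ).2 hn), hs.toFunctional_eq hn,
    hn.t₀_reverse, hn.tStop_reverse]
  have h1 : ∫ t in (γ.t₀ : ℝ)..γ.tStop, ω (γ.reverse.extend t) (deriv γ.reverse.extend t)
      = ∫ t in (γ.t₀ : ℝ)..γ.tStop, -(ω (γ.extend (γ.t₀ + γ.tStop - t))
          (deriv γ.extend (γ.t₀ + γ.tStop - t))) := by
    refine intervalIntegral.integral_congr_Ioo_of_le hle fun t ht => ?_
    have ht0 : 0 < t := γ.t₀.coe_nonneg.trans_lt ht.1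
    have hev : γ.reverse.extend =ᶠ[𝓝 t] fun u => γ.extend (γ.t₀ + γ.tStop - u) := by
      filter_upwards [lt_mem_nhds ht0] with u hu using γ.extend_reverse hu.le
    change ω (γ.reverse.extend t) (deriv γ.reverse.extend t) = _
    rw [hev.deriv_eq, deriv_comp_const_sub, γ.extend_reverse ht0.le, map_neg]
  rw [h1, intervalIntegral.integral_neg,
    intervalIntegral.integral_comp_sub_left
      (fun t => ω (γ.extend t) (deriv γ.extend t)) ((γ.t₀ : ℝ) + γ.tStop)]
  simp

end Curve
end TransportPaths

/-! ### Currents that are integrals of curves -/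

namespace TransportPaths

variable {d : ℕ}

theorem ofReal_le_mass {V : Type} [NormedAddCommGroup V] [NormedSpace ℝ V]
    (F : 𝓓((⊤ : Opens (E d)), V) → ℝ) {ω : 𝓓((⊤ : Opens (E d)), V)} (hω : ∀ x, ‖ω x‖ ≤ 1) :
    ENNReal.ofReal (F ω) ≤ mass F :=
  le_iSup₂ (f := fun (ω : 𝓓((⊤ : Opens (E d)), V)) (_ : ∀ x, ‖ω x‖ ≤ 1) => ENNReal.ofReal (F ω)) ω hω

theorem enorm_le_mul_mass {F : Form1 d → ℝ} (hF : ∀ (c : ℝ) ω, F (c • ω) = c * F ω)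
    {ω : Form1 d} {C : ℝ} (hC : 0 < C) (hω : ∀ x, ‖ω x‖ ≤ C) :
    ‖F ω‖ₑ ≤ ENNReal.ofReal C * mass F := by
  have h1 : ∀ c : ℝ, |c| = C⁻¹ → ENNReal.ofReal (c * F ω) ≤ mass F := fun c hc => by
    rw [← hF]
    refine ofReal_le_mass F fun x => ?_
    change ‖c • ω x‖ ≤ 1
    rw [norm_smul, Real.norm_eq_abs, hc]
    exact inv_mul_le_one_of_le₀ (hω x) hC.le
  have h2 : ENNReal.ofReal (C⁻¹ * |F ω|) ≤ mass F := by
    rcases abs_choice (F ω) with h | h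
    · rw [h]; exact h1 _ (abs_of_pos (inv_pos.2 hC))
    · rw [h, mul_neg, ← neg_mul]
      exact h1 _ (by rw [abs_neg, abs_of_pos (inv_pos.2 hC)])
  calc ‖F ω‖ₑ = ENNReal.ofReal C * ENNReal.ofReal (C⁻¹ * |F ω|) := by
        rw [← ENNReal.ofReal_mul hC.le, mul_inv_cancel_left₀ hC.ne', Real.enorm_eq_ofReal_abs]
    _ ≤ _ := by gcongr

theorem mass_add_le (S T : Current1 d) : mass (S + T : Current1 d) ≤ mass S + mass T := by
  refine iSup₂_le fun ω hω => ?_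
  calc ENNReal.ofReal ((S + T) ω) ≤ ENNReal.ofReal (S ω) + ENNReal.ofReal (T ω) :=
        ENNReal.ofReal_add_le
    _ ≤ _ := add_le_add (ofReal_le_mass S hω) (ofReal_le_mass T hω)

/-- A linear functional that is bounded in the supremum norm is a current. -/
theorem exists_current_of_bound (L : Form1 d → ℝ) (hadd : ∀ ω ω', L (ω + ω') = L ω + L ω')
    (hsmul : ∀ (c : ℝ) ω, L (c • ω) = c * L ω) (A : ℝ)
    (hb : ∀ (ω : Form1 d) (C : ℝ), 0 < C → (∀ x, ‖ω x‖ ≤ C) → |L ω| ≤ C * A) :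
    ∃ T : Current1 d, ∀ ω, T ω = L ω := by
  let Φ : Form1 d →ₗ[ℝ] ℝ := { toFun := L, map_add' := hadd, map_smul' := hsmul }
  let B := TestFunction.toBoundedContinuousFunctionCLM (Ω := (⊤ : Opens (E d))) (n := ⊤)
    (F := E d →L[ℝ] ℝ) ℝ
  have hA : 0 ≤ A := by
    have := hb 0 1 one_pos (fun x => by simp)
    linarith [abs_nonneg (L 0)]
  have hle : ∀ ω, ‖Φ ω‖ ≤ ‖B ω‖ * A := fun ω => by
    refine le_of_forall_pos_le_add fun ε hε => ?_
    have hx : ∀ x, ‖ω x‖ ≤ ‖B ω‖ := fun x => (B ω).norm_coe_le_norm x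
    have h2 : |L ω| ≤ (‖B ω‖ + ε / (A + 1)) * A :=
      hb ω _ (by positivity) fun x => (hx x).trans (by linarith [show 0 < ε / (A + 1) by positivity])
    have h3 : ε / (A + 1) * A ≤ ε := by
      rw [div_mul_eq_mul_div, div_le_iff₀ (by positivity)]
      nlinarith
    change |L ω| ≤ _
    linarith
  have hc : Continuous Φ := by
    refine continuous_of_continuousAt_zero Φ ?_
    rw [ContinuousAt, map_zero]
    have h0 : Tendsto (fun ω => ‖B ω‖ * A) (𝓝 0) (𝓝 0) := by
      have : Continuous fun ω => ‖B ω‖ * A := by fun_prop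
      simpa using this.tendsto 0
    exact squeeze_zero_norm hle h0
  exact ⟨⟨Φ, hc⟩, fun ω => rfl⟩

/-- A family of simple curves of finite total mass defines a current. -/
theorem exists_isIntegralOfCurves {η : Measure (Curve d)}
    (hη : ∀ᵐ γ ∂η, γ.IsNonconstant ∧ γ.IsSimple)
    (hint : ∀ ω, Integrable (fun γ : Curve d => γ.toFunctional ω) η)
    (hmass : ∫⁻ γ, mass γ.toFunctional ∂η ≠ ∞) :
    ∃ T : Current1 d, IsIntegralOfCurves T η := by
  obtain ⟨T, hT⟩ := exists_current_of_bound (fun ω => ∫ γ : Curve d, γ.toFunctional ω ∂η)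
    (fun ω ω' => by
      rw [← integral_add (hint ω) (hint ω')]
      refine integral_congr_ae ?_
      filter_upwards [hη] with γ hγ using hγ.2.toFunctional_add hγ.1 ω ω')
    (fun c ω => by
      rw [← integral_const_mul]
      simp_rw [Curve.toFunctional_smul])
    (∫⁻ γ, mass γ.toFunctional ∂η).toReal (fun ω C hC hω => by
      rw [← Real.norm_eq_abs, ← toReal_enorm]
      refine ENNReal.toReal_le_of_le_ofReal (by positivity) ?_
      rw [ENNReal.ofReal_mul hC.le, ENNReal.ofReal_toReal hmass,
        ← lintegral_const_mul' _ _ ENNReal.ofReal_ne_top]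
      exact (enorm_integral_le_lintegral_enorm _).trans
        (lintegral_mono fun γ => enorm_le_mul_mass (γ.toFunctional_smul) hC hω))
  exact ⟨T, fun ω => ⟨hint ω, hT ω⟩⟩

theorem IsIntegralOfCurves.mass_le {T : Current1 d} {η : Measure (Curve d)}
    (h : IsIntegralOfCurves T η) : mass T ≤ ∫⁻ γ, mass γ.toFunctional ∂η := by
  refine iSup₂_le fun ω hω => ?_
  calc ENNReal.ofReal (T ω) ≤ ‖T ω‖ₑ := by
        rw [Real.enorm_eq_ofReal_abs]; exact ENNReal.ofReal_le_ofReal (le_abs_self _)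
    _ ≤ ∫⁻ γ, ‖γ.toFunctional ω‖ₑ ∂η := by
        rw [(h ω).2]; exact enorm_integral_le_lintegral_enorm _
    _ ≤ _ := lintegral_mono fun γ => by
        simpa using enorm_le_mul_mass γ.toFunctional_smul one_pos hω

theorem IsIntegralOfCurves.boundary_eq {T : Current1 d} {η : Measure (Curve d)}
    [IsFiniteMeasure η] (h : IsIntegralOfCurves T η)
    (hη : ∀ᵐ γ ∂η, γ.IsNonconstant ∧ γ.IsSimple) (f : Form0 d) :
    boundary T f
      = ∫ z, f z ∂(η.map Curve.endPoint) - ∫ z, f z ∂(η.map Curve.startPoint) := by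
  have hi : ∀ p : Curve d → E d, Measurable p → Integrable (fun γ => f (p γ)) η := fun p hp => by
    obtain ⟨C, hC⟩ := f.hasCompactSupport.exists_bound_of_continuous f.continuous
    exact Integrable.of_bound (f.continuous.measurable.comp hp).aestronglyMeasurable C
      (ae_of_all _ fun γ => hC _)
  rw [integral_map Curve.measurable_endPoint.aemeasurable f.continuous.aestronglyMeasurable,
    integral_map Curve.measurable_startPoint.aemeasurable f.continuous.aestronglyMeasurable,
    ← integral_sub (hi _ Curve.measurable_endPoint) (hi _ Curve.measurable_startPoint)]
  unfold boundary
  rw [(h _).2]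
  refine integral_congr_ae ?_
  filter_upwards [hη] with γ hγ using hγ.2.boundary_toFunctional hγ.1 f

/-- Reversing all curves changes the sign of the current. -/
theorem IsIntegralOfCurves.map_reverse {T : Current1 d} {η : Measure (Curve d)}
    (h : IsIntegralOfCurves T η) (hη : ∀ᵐ γ ∂η, γ.IsNonconstant ∧ γ.IsSimple) :
    IsIntegralOfCurves (-T) (η.map Curve.reverseEquiv) := by
  intro ω
  have hae : (fun γ : Curve d => (Curve.reverseEquiv γ).toFunctional ω)
      =ᵐ[η] fun γ => -γ.toFunctional ω := by
    filter_upwards [hη] with γ hγ using hγ.2.toFunctional_reverse hγ.1 ω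
  rw [integrable_map_equiv, integral_map_equiv]
  refine ⟨(h ω).1.neg.congr hae.symm, ?_⟩
  rw [integral_congr_ae hae, integral_neg, ← (h ω).2]
  rfl

/-- Restricting a mass-optimal family of curves to a set of curves and to its complement splits the
current into subcurrents: the masses of the two parts cannot exceed those of the families, and these
add up to the mass of the whole. -/
theorem IsIntegralOfCurves.mass_add_mass_eq {T T₁ T₂ : Current1 d} {η : Measure (Curve d)}
    {B : Set (Curve d)} (hB : MeasurableSet B) (hmass : mass T = ∫⁻ γ, mass γ.toFunctional ∂η)
    (h₁ : IsIntegralOfCurves T₁ (η.restrict B)) (h₂ : IsIntegralOfCurves T₂ (η.restrict Bᶜ))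
    (hT : T = T₁ + T₂) : mass T₁ + mass T₂ = mass T := by
  refine le_antisymm ?_ (hT ▸ mass_add_le T₁ T₂)
  rw [hmass, ← lintegral_add_compl _ hB]
  exact add_le_add h₁.mass_le h₂.mass_le

end TransportPaths

/-! ### Splitting of the mass on test forms -/

namespace TransportPaths

variable {d : ℕ}

/-- The smooth compactly supported 1-form with given coefficients. -/
def mkForm1 (u : E d → E d →L[ℝ] ℝ) (hu : ContDiff ℝ (⊤ : ℕ∞) u) (hc : HasCompactSupport u) :
    Form1 d :=
  ⟨u, hu, hc, fun _ _ => trivial⟩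

theorem mkForm1_apply (u : E d → E d →L[ℝ] ℝ) (hu : ContDiff ℝ (⊤ : ℕ∞) u)
    (hc : HasCompactSupport u) (z : E d) : mkForm1 u hu hc z = u z := rfl

theorem Form1.contDiff (ω : Form1 d) : ContDiff ℝ (⊤ : ℕ∞) ω := TestFunction.contDiff ω

/-- The identification of covectors with vectors, as a continuous linear map. -/
noncomputable def sharp : (E d →L[ℝ] ℝ) →L[ℝ] E d :=
  LinearMap.mkContinuous
    { toFun := fun a => (InnerProductSpace.toDual ℝ (E d)).symm a
      map_add' := fun a b => by simp
      map_smul' := fun c a => by simp } 1 (fun a => by simp)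

theorem inner_sharp (a : E d →L[ℝ] ℝ) (v : E d) : inner ℝ (sharp a) v = a v :=
  InnerProductSpace.toDual_symm_apply

theorem norm_sharp (a : E d →L[ℝ] ℝ) : ‖sharp a‖ = ‖a‖ :=
  (InnerProductSpace.toDual ℝ (E d)).symm.norm_map a

theorem Form1.contDiff_norm_sq (ω : Form1 d) : ContDiff ℝ (⊤ : ℕ∞) fun z => ‖ω z‖ ^ 2 := by
  simp_rw [← norm_sharp]
  exact ((sharp (d := d)).contDiff.comp ω.contDiff).norm_sq ℝ

theorem Form1.integrable_apply {μ : Measure (E d)} [IsLocallyFiniteMeasure μ] (ω : Form1 d)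
    {ξ : E d → E d} (hξ : AEStronglyMeasurable ξ μ) (hb : ∀ᵐ z ∂μ, ‖ξ z‖ ≤ 1) :
    Integrable (fun z => ω z (ξ z)) μ := by
  have hω : Integrable (fun z => ω z) μ :=
    ω.continuous.integrable_of_hasCompactSupport ω.hasCompactSupport
  refine hω.norm.mono ?_ ?_
  · exact (continuous_fst.clm_apply continuous_snd).comp_aestronglyMeasurable
      (hω.aestronglyMeasurable.prodMk hξ)
  · filter_upwards [hb] with z hz
    rw [norm_norm]
    exact (ω z).le_of_opNorm_le_of_le le_rfl hz |>.trans (by simp)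

/-- Forms of pointwise norm at most one nearly attain the mass. -/
theorem exists_lt_apply_of_lt_mass {T : Current1 d} {m : ℝ}
    (hm : m < (mass T).toReal) : ∃ α : Form1 d, (∀ z, ‖α z‖ ≤ 1) ∧ m < T α := by
  by_contra! hcon
  have h0 : 0 ≤ m := by simpa using hcon 0 fun z => by simp
  have h3 : mass T ≤ ENNReal.ofReal m :=
    iSup₂_le fun α hα => ENNReal.ofReal_le_ofReal (hcon α hα)
  exact (ENNReal.toReal_le_of_le_ofReal h0 h3).not_gt hm

theorem apply_le_mass {T : Current1 d} (hT : mass T ≠ ∞) {α : Form1 d} (hα : ∀ z, ‖α z‖ ≤ 1) :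
    T α ≤ (mass T).toReal :=
  (ENNReal.ofReal_le_iff_le_toReal hT).1 (ofReal_le_mass T hα)

/-- If a current of finite mass splits into parts whose masses add up, any form that nearly attains
the mass of the whole nearly attains the mass of both parts. Comparing with it the forms that are
pointwise at most `g` bounds the action of the two parts, on independent forms, by the integral of
`g` against the mass measure of the whole. -/
theorem apply_add_apply_le_of_le_one {T₁ T₂ : Current1 d} (h₁ : mass T₁ ≠ ∞) (h₂ : mass T₂ ≠ ∞)
    (hadd : mass T₁ + mass T₂ = mass (T₁ + T₂ : Current1 d)) {μ : Measure (E d)} [IsFiniteMeasure μ]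
    {ξ : E d → E d} (hb : ∀ᵐ z ∂μ, ‖ξ z‖ ≤ 1)
    (hT : ∀ ω, (T₁ + T₂) ω = ∫ z, ω z (ξ z) ∂μ) {g : E d → ℝ} (hg : ContDiff ℝ (⊤ : ℕ∞) g)
    (hg1 : ∀ z, g z ≤ 1) {ω ω' : Form1 d} (hω : ∀ z, ‖ω z‖ ≤ g z) (hω' : ∀ z, ‖ω' z‖ ≤ g z) :
    T₁ ω + T₂ ω' ≤ ∫ z, g z ∂μ := by
  have hg0 : ∀ z, 0 ≤ g z := fun z => (norm_nonneg _).trans (hω z)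
  by_contra! hlt
  have hm : (mass T₁).toReal + (mass T₂).toReal = (mass (T₁ + T₂ : Current1 d)).toReal := by
    rw [← hadd, ENNReal.toReal_add h₁ h₂]
  obtain ⟨α, hα, hαT⟩ := exists_lt_apply_of_lt_mass
    (m := (mass (T₁ + T₂ : Current1 d)).toReal - (T₁ ω + T₂ ω' - ∫ z, g z ∂μ))
    (sub_lt_self _ (sub_pos.2 hlt))
  have hc : HasCompactSupport fun z => g z • α z :=
    α.hasCompactSupport.mono fun z hz h0 => hz (by simp [h0])
  obtain ⟨β, hβ⟩ : ∃ β : Form1 d, ∀ z, β z = g z • α z :=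
    ⟨mkForm1 (fun z => g z • α z) (hg.smul α.contDiff) hc, mkForm1_apply _ _ _⟩
  -- compare the nearly optimal `α` with `(1 - g) α + ω`
  have hcomp : ∀ ω : Form1 d, (∀ z, ‖ω z‖ ≤ g z) → ∀ z, ‖(α - β + ω) z‖ ≤ 1 := by
    intro ω hω z
    have h1 : (α - β + ω) z = (1 - g z) • α z + ω z := by
      change α z - β z + ω z = _
      rw [hβ]
      ext v
      change α z v - g z * α z v + ω z v = (1 - g z) * α z v + ω z v
      ring
    rw [h1]
    calc _ ≤ ‖(1 - g z) • α z‖ + ‖ω z‖ := norm_add_le _ _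
      _ ≤ (1 - g z) * 1 + g z := by
        rw [norm_smul, Real.norm_of_nonneg (sub_nonneg.2 (hg1 z))]
        exact add_le_add (mul_le_mul_of_nonneg_left (hα z) (sub_nonneg.2 (hg1 z))) (hω z)
      _ = 1 := by ring
  have e1 := apply_le_mass h₁ (hcomp ω hω)
  have e2 := apply_le_mass h₂ (hcomp ω' hω')
  rw [map_add, map_sub] at e1 e2
  have e3 : (T₁ + T₂) β ≤ ∫ z, g z ∂μ := by
    rw [hT]
    refine (Real.le_norm_self _).trans (norm_integral_le_of_norm_le ?_ ?_)
    · exact Integrable.of_bound hg.continuous.aestronglyMeasurable 1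
        (ae_of_all _ fun z => by rw [Real.norm_of_nonneg (hg0 z)]; exact hg1 z)
    · filter_upwards [hb] with z hz
      rw [hβ, smul_apply, norm_smul, Real.norm_of_nonneg (hg0 z)]
      refine mul_le_of_le_one_right (hg0 z) ?_
      simpa using (α z).le_of_opNorm_le_of_le (hα z) hz
  rw [add_apply] at e3 hαT
  linarith

/-- The bound of `apply_add_apply_le_of_le_one` for an arbitrary bounded `g`, by scaling. -/
theorem apply_add_apply_le {T₁ T₂ : Current1 d} (h₁ : mass T₁ ≠ ∞) (h₂ : mass T₂ ≠ ∞)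
    (hadd : mass T₁ + mass T₂ = mass (T₁ + T₂ : Current1 d)) {μ : Measure (E d)} [IsFiniteMeasure μ]
    {ξ : E d → E d} (hb : ∀ᵐ z ∂μ, ‖ξ z‖ ≤ 1)
    (hT : ∀ ω, (T₁ + T₂) ω = ∫ z, ω z (ξ z) ∂μ) {g : E d → ℝ} (hg : ContDiff ℝ (⊤ : ℕ∞) g)
    {K : ℝ} (hK : ∀ z, g z ≤ K) {ω ω' : Form1 d} (hω : ∀ z, ‖ω z‖ ≤ g z)
    (hω' : ∀ z, ‖ω' z‖ ≤ g z) : T₁ ω + T₂ ω' ≤ ∫ z, g z ∂μ := by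
  have hc : 0 < (max K 1)⁻¹ := by positivity
  have hs : ∀ α : Form1 d, (∀ z, ‖α z‖ ≤ g z) →
      ∀ z, ‖((max K 1)⁻¹ • α) z‖ ≤ (max K 1)⁻¹ * g z := fun α hα z => by
    change ‖(max K 1)⁻¹ • α z‖ ≤ _
    rw [norm_smul, Real.norm_of_nonneg hc.le]
    exact mul_le_mul_of_nonneg_left (hα z) hc.le
  have := apply_add_apply_le_of_le_one h₁ h₂ hadd hb hT (g := fun z => (max K 1)⁻¹ * g z)
    (contDiff_const.mul hg)
    (fun z => inv_mul_le_one_of_le₀ ((hK z).trans (le_max_left _ _)) (by positivity))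
    (hs ω hω) (hs ω' hω')
  rw [map_smul, map_smul, smul_eq_mul, smul_eq_mul, ← mul_add, integral_const_mul] at this
  exact le_of_mul_le_mul_left this hc

/-- A function whose integral against all non-negative smooth test functions is non-positive is
non-positive almost everywhere. -/
theorem ae_nonpos_of_integral_smooth_mul_nonpos {μ : Measure (E d)} [IsFiniteMeasure μ]
    {f : E d → ℝ} (hf : Integrable f μ)
    (h : ∀ g : E d → ℝ, ContDiff ℝ (⊤ : ℕ∞) g → HasCompactSupport g → (∀ z, 0 ≤ g z) →
      (∀ z, g z ≤ 1) → ∫ z, g z * f z ∂μ ≤ 0) : ∀ᵐ z ∂μ, f z ≤ 0 := by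
  set ν : Measure (E d) := μ.withDensity fun z => ‖f z‖ₑ with hν
  have hfin : IsFiniteMeasure ν := isFiniteMeasure_withDensity hf.2.ne
  have hνr : ∀ A, MeasurableSet A → ∫ z in A, ‖f z‖ ∂μ = (ν A).toReal := fun A hA => by
    rw [hν, withDensity_apply _ hA, integral_norm_eq_lintegral_enorm hf.1.restrict]
  have hclose : ∀ (ε : ℝ≥0∞) (A B : Set (E d)), ε ≠ ∞ → MeasurableSet (A \ B) → ν (A \ B) < ε →
      ∫ z in A \ B, ‖f z‖ ∂μ ≤ ε.toReal := fun ε A B h hm hlt => by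
    rw [hνr _ hm]
    exact ENNReal.toReal_mono h hlt.le
  have hK : ∀ K : Set (E d), IsCompact K → ∫ z in K, f z ∂μ ≤ 0 := by
    intro K hK
    refine le_of_forall_pos_le_add fun ε hε => ?_
    -- a smooth `g` with `1_K ≤ g ≤ 1_W`, where `W ⊇ K` is so small that `∫ g f` is close to `∫_K f`
    obtain ⟨U, hKU, hU, hνU⟩ := K.exists_isOpen_lt_add (μ := ν) (measure_ne_top ν K)
      (ε := ENNReal.ofReal ε) (by simpa using hε)
    obtain ⟨R, hR⟩ := hK.isBounded.subset_ball 0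
    set W := U ∩ Metric.ball (0 : E d) R
    have hW : IsOpen W := hU.inter Metric.isOpen_ball
    have hKW : K ⊆ W := subset_inter hKU hR
    obtain ⟨g, hg0, hg1, hg⟩ := exists_contMDiffMap_zero_one_of_isClosed (n := ⊤)
      (modelWithCornersSelf ℝ (E d)) hW.isClosed_compl hK.isClosed
      (disjoint_compl_left_iff_subset.2 hKW)
    have hgd : ContDiff ℝ (⊤ : ℕ∞) g := g.contMDiff.contDiff
    have hgc : HasCompactSupport g := by
      refine HasCompactSupport.intro (isCompact_closedBall (0 : E d) R) fun z hz => hg0 fun hzW => ?_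
      exact hz (Metric.ball_subset_closedBall hzW.2)
    have hdiff : ν (W \ K) < ENNReal.ofReal ε := by
      rw [measure_sdiff hKW hK.measurableSet.nullMeasurableSet (measure_ne_top ν K)]
      refine ENNReal.sub_lt_of_lt_add (measure_mono hKW) ?_
      rw [add_comm]
      exact (measure_mono inter_subset_left).trans_lt hνU
    have hgf : Integrable (fun z => g z * f z) μ :=
      hf.bdd_mul hgd.continuous.aestronglyMeasurable (c := 1)
        (ae_of_all _ fun z => by rw [Real.norm_of_nonneg (hg z).1]; exact (hg z).2)
    have h1 : ∫ z in K, f z ∂μ - ∫ z, g z * f z ∂μ ≤ ∫ z in W \ K, ‖f z‖ ∂μ := by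
      rw [← integral_indicator hK.measurableSet, ← integral_indicator
        (hW.measurableSet.diff hK.measurableSet),
        ← integral_sub (hf.indicator hK.measurableSet) hgf]
      refine integral_mono ((hf.indicator hK.measurableSet).sub hgf)
        (hf.norm.indicator (hW.measurableSet.diff hK.measurableSet)) fun z => ?_
      by_cases hzK : z ∈ K
      · have : g z = 1 := hg1 hzK
        simp [hzK, this]
      · by_cases hzW : z ∈ W
        · simp only [indicator_of_notMem hzK, zero_sub,
            indicator_of_mem (show z ∈ W \ K from ⟨hzW, hzK⟩)]
          rw [← neg_mul]
          refine (Real.le_norm_self _).trans ?_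
          rw [norm_mul, norm_neg, Real.norm_of_nonneg (hg z).1]
          exact mul_le_of_le_one_left (norm_nonneg _) (hg z).2
        · have : g z = 0 := hg0 hzW
          simp [hzK, this, hzW]
    have h2 := hclose _ W K ENNReal.ofReal_ne_top (hW.measurableSet.diff hK.measurableSet) hdiff
    rw [ENNReal.toReal_ofReal hε.le] at h2
    have h3 := h g hgd hgc (fun z => (hg z).1) fun z => (hg z).2
    linarith
  have hS : ∀ S : Set (E d), MeasurableSet S → ∫ z in S, f z ∂μ ≤ 0 := by
    intro S hS
    refine le_of_forall_pos_le_add fun ε hε => ?_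
    obtain ⟨K, hKS, hKc, hKν⟩ := hS.exists_isCompact_sdiff_lt (μ := ν) (measure_ne_top ν S)
      (ε := ENNReal.ofReal ε) (by simpa using hε)
    have h2 := hclose _ S K ENNReal.ofReal_ne_top (hS.diff hKc.measurableSet) hKν
    rw [ENNReal.toReal_ofReal hε.le] at h2
    have h3 : ∫ z in S \ K, f z ∂μ ≤ ∫ z in S \ K, ‖f z‖ ∂μ :=
      (Real.le_norm_self _).trans (norm_integral_le_integral_norm _)
    have h4 := setIntegral_sdiff hKc.measurableSet hf.integrableOn hKS
    linarith [hK K hKc]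
  have := ae_nonneg_of_forall_setIntegral_nonneg hf.neg fun S hm _ => by
    have := hS S hm
    simp only [Pi.neg_apply, integral_neg]
    linarith
  filter_upwards [this] with z hz
  simpa using hz

end TransportPaths

/-! ### Square integrable fields and test forms -/

/-- The Riesz representation of a linear functional that is bounded relative to a seminorm induced
from a Hilbert space. -/
theorem exists_inner_eq_of_le_norm {V H : Type*} [AddCommGroup V] [Module ℝ V]
    [NormedAddCommGroup H] [InnerProductSpace ℝ H] [CompleteSpace H] (J : V →ₗ[ℝ] H)
    (L : V →ₗ[ℝ] ℝ) {C : ℝ} (h : ∀ v, L v ≤ C * ‖J v‖) : ∃ w : H, ∀ v, L v = inner ℝ w (J v) := by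
  have hker : L ∈ (LinearMap.ker J).dualAnnihilator := by
    rw [Submodule.mem_dualAnnihilator]
    intro v hv
    have h1 := h v
    have h2 := h (-v)
    rw [map_neg, map_neg, norm_neg] at h2
    rw [LinearMap.mem_ker.1 hv, norm_zero, mul_zero] at h1 h2
    linarith
  rw [← LinearMap.range_dualMap_eq_dualAnnihilator_ker] at hker
  obtain ⟨f, hf⟩ := hker
  have hfv : ∀ v, f (J v) = L v := fun v => by rw [← hf]; rfl
  have hb : ∀ x : LinearMap.range J, ‖f.comp (LinearMap.range J).subtype x‖ ≤ C * ‖x‖ := by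
    rintro ⟨_, v, rfl⟩
    change |f (J v)| ≤ C * ‖J v‖
    rw [hfv, abs_le]
    have h2 := h (-v)
    rw [map_neg, map_neg, norm_neg] at h2
    exact ⟨by linarith, h v⟩
  obtain ⟨g, hg, -⟩ := exists_extension_norm_eq (LinearMap.range J)
    (LinearMap.mkContinuous (f.comp (LinearMap.range J).subtype) C hb)
  refine ⟨(InnerProductSpace.toDual ℝ H).symm g, fun v => ?_⟩
  rw [InnerProductSpace.toDual_symm_apply, ← hfv]
  exact (hg ⟨J v, v, rfl⟩).symm

namespace TransportPaths

variable {d : ℕ}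

theorem Form1.memLp_sharp (μ : Measure (E d)) [IsFiniteMeasure μ] (ω : Form1 d) :
    MemLp (fun z => sharp (ω z)) 2 μ :=
  ((sharp (d := d)).continuous.comp ω.continuous).memLp_of_hasCompactSupport
    (ω.hasCompactSupport.comp_left (map_zero _))

/-- The inclusion of the test forms into the space of square integrable vector fields. -/
noncomputable def toL2 (μ : Measure (E d)) [IsFiniteMeasure μ] : Form1 d →ₗ[ℝ] Lp (E d) 2 μ where
  toFun ω := (ω.memLp_sharp μ).toLp
  map_add' ω ω' := by
    rw [← MemLp.toLp_add]
    refine MemLp.toLp_congr _ _ (ae_of_all _ fun z => ?_)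
    exact map_add sharp (ω z) (ω' z)
  map_smul' c ω := by
    rw [RingHom.id_apply, ← MemLp.toLp_const_smul]
    refine MemLp.toLp_congr _ _ (ae_of_all _ fun z => ?_)
    exact map_smul sharp c (ω z)

theorem coeFn_toL2 (μ : Measure (E d)) [IsFiniteMeasure μ] (ω : Form1 d) :
    toL2 μ ω =ᵐ[μ] fun z => sharp (ω z) :=
  (ω.memLp_sharp μ).coeFn_toLp

theorem inner_toL2 (μ : Measure (E d)) [IsFiniteMeasure μ] (v : Lp (E d) 2 μ) (ω : Form1 d) :
    inner ℝ v (toL2 μ ω) = ∫ z, ω z (v z) ∂μ := by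
  rw [L2.inner_def]
  refine integral_congr_ae ?_
  filter_upwards [coeFn_toL2 μ ω] with z hz
  rw [hz, real_inner_comm, inner_sharp]

theorem norm_sq_toL2_sub (μ : Measure (E d)) [IsFiniteMeasure μ] (ω : Form1 d) {ξ : E d → E d}
    (hξ : MemLp ξ 2 μ) : ‖toL2 μ ω - hξ.toLp‖ ^ 2 = ∫ z, ‖sharp (ω z) - ξ z‖ ^ 2 ∂μ := by
  rw [← real_inner_self_eq_norm_sq, L2.inner_def]
  refine integral_congr_ae ?_
  filter_upwards [coeFn_toL2 μ ω, hξ.coeFn_toLp, Lp.coeFn_sub (toL2 μ ω) hξ.toLp]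
    with z h1 h2 h3
  rw [h3, Pi.sub_apply, h1, h2, real_inner_self_eq_norm_sq]

theorem norm_sq_toL2 (μ : Measure (E d)) [IsFiniteMeasure μ] (ω : Form1 d) :
    ‖toL2 μ ω‖ ^ 2 = ∫ z, ‖ω z‖ ^ 2 ∂μ := by
  rw [← real_inner_self_eq_norm_sq, L2.inner_def]
  refine integral_congr_ae ?_
  filter_upwards [coeFn_toL2 μ ω] with z hz
  rw [hz, real_inner_self_eq_norm_sq, norm_sharp]

/-- The test form `g ⟨a, ·⟩`. -/
noncomputable def scalarForm (g : E d → ℝ) (hg : ContDiff ℝ (⊤ : ℕ∞) g) (hc : HasCompactSupport g)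
    (a : E d) : Form1 d :=
  mkForm1 (fun z => g z • innerSL ℝ a) (hg.smul contDiff_const)
    (hc.mono fun z hz h0 => hz (by simp [h0]))

theorem scalarForm_apply {g : E d → ℝ} (hg : ContDiff ℝ (⊤ : ℕ∞) g) (hc : HasCompactSupport g)
    (a z v : E d) : scalarForm g hg hc a z v = g z * inner ℝ a v := rfl

theorem norm_scalarForm {g : E d → ℝ} (hg : ContDiff ℝ (⊤ : ℕ∞) g) (hc : HasCompactSupport g)
    (a z : E d) : ‖scalarForm g hg hc a z‖ = |g z| * ‖a‖ := by
  rw [scalarForm, mkForm1_apply, norm_smul, innerSL_apply_norm, Real.norm_eq_abs]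

/-- A square integrable field is determined by its action on the test forms. -/
theorem ae_eq_of_forall_integral_form_eq {μ : Measure (E d)} [IsFiniteMeasure μ] {v w : E d → E d}
    (hv : Integrable v μ) (hw : Integrable w μ)
    (h : ∀ ω : Form1 d, ∫ z, ω z (v z) ∂μ = ∫ z, ω z (w z) ∂μ) : v =ᵐ[μ] w := by
  refine ae_eq_of_integral_contDiff_smul_eq hv.locallyIntegrable hw.locallyIntegrable ?_
  intro g hg hc
  have hi : ∀ u : E d → E d, Integrable u μ → Integrable (fun z => g z • u z) μ := fun u hu => by
    obtain ⟨C, hC⟩ := hc.exists_bound_of_continuous hg.continuous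
    exact hu.bdd_smul C hg.continuous.aestronglyMeasurable (ae_of_all _ hC)
  refine ext_inner_left ℝ fun a => ?_
  rw [← integral_inner (hi v hv), ← integral_inner (hi w hw)]
  simp_rw [inner_smul_right]
  exact h (scalarForm g hg hc a)

/-- The test forms are dense in `L²`, as their orthogonal complement is trivial by
`ae_eq_of_forall_integral_form_eq`. -/
theorem exists_form_integral_norm_sub_sq_lt {μ : Measure (E d)} [IsFiniteMeasure μ] {ξ : E d → E d}
    (hξ : MemLp ξ 2 μ) {ε : ℝ} (hε : 0 < ε) :
    ∃ ω : Form1 d, ∫ z, ‖sharp (ω z) - ξ z‖ ^ 2 ∂μ < ε := by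
  have hdense : (LinearMap.range (toL2 μ)).topologicalClosure = ⊤ := by
    rw [Submodule.topologicalClosure_eq_top_iff, Submodule.eq_bot_iff]
    intro v hv
    rw [Submodule.mem_orthogonal'] at hv
    have h0 : v =ᵐ[μ] fun _ => (0 : E d) := by
      refine ae_eq_of_forall_integral_form_eq ((Lp.memLp v).integrable one_le_two)
        (integrable_zero _ _ _) fun ω => ?_
      rw [← inner_toL2, hv _ ⟨ω, rfl⟩]
      simp
    exact (Lp.eq_zero_iff_ae_eq_zero).2 h0
  have hmem : hξ.toLp ∈ (LinearMap.range (toL2 μ)).topologicalClosure := by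
    rw [hdense]; trivial
  obtain ⟨_, ⟨ω, rfl⟩, hω⟩ := Metric.mem_closure_iff.1 hmem (Real.sqrt ε) (Real.sqrt_pos.2 hε)
  refine ⟨ω, ?_⟩
  rw [← norm_sq_toL2_sub μ ω hξ, ← dist_eq_norm, dist_comm]
  exact (Real.lt_sqrt dist_nonneg).1 hω

/-- The measure `μ` of a current `ξ μ` with unit `ξ` is at most its mass. If forms `ω` approximate
`ξ`, then so do the forms `2 ω / (1 + ‖ω‖²)`, whose norm is at most one. -/
theorem measure_univ_le_mass {T : Current1 d} {μ : Measure (E d)} [IsLocallyFiniteMeasure μ]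
    {ξ : E d → E d} (hξ : AEStronglyMeasurable ξ μ) (hn : ∀ᵐ z ∂μ, ‖ξ z‖ = 1)
    (hT : ∀ ω, T ω = ∫ z, ω z (ξ z) ∂μ) : μ univ ≤ mass T := by
  have hball : ∀ n : ℕ, μ (Metric.closedBall 0 n) ≤ mass T := by
    intro n
    let χ : ContDiffBump (0 : E d) := ⟨n + 1, n + 2, by positivity, by linarith⟩
    set B := Metric.closedBall (0 : E d) (n + 2)
    have hBf : IsFiniteMeasure (μ.restrict B) :=
      isFiniteMeasure_restrict.2 (isCompact_closedBall _ _).measure_lt_top.ne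
    have hξ2 : MemLp ξ 2 (μ.restrict B) :=
      MemLp.of_bound hξ.restrict 1 (ae_restrict_of_ae (hn.mono fun z hz => hz.le))
    have hχ0 : ∀ z, z ∉ B → χ z = 0 := fun z hz => by
      refine χ.zero_of_le_dist ?_
      rw [Metric.mem_closedBall, not_le] at hz
      exact hz.le
    refine ENNReal.le_of_forall_pos_le_add fun ε hε _ => ?_
    obtain ⟨ω, hω⟩ := exists_form_integral_norm_sub_sq_lt hξ2 (ε := ε) (by exact_mod_cast hε)
    have hsm : ContDiff ℝ (⊤ : ℕ∞) fun z => χ z * (2 / (1 + ‖ω z‖ ^ 2)) :=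
      χ.contDiff.mul (contDiff_const.div (contDiff_const.add ω.contDiff_norm_sq)
        fun z => by positivity)
    obtain ⟨α, hα⟩ : ∃ α : Form1 d, ∀ z, α z = (χ z * (2 / (1 + ‖ω z‖ ^ 2))) • ω z :=
      ⟨mkForm1 _ (hsm.smul ω.contDiff)
        (χ.hasCompactSupport.mono fun z hz h0 => hz (by simp [h0])), mkForm1_apply _ _ _⟩
    have hα1 : ∀ z, ‖α z‖ ≤ 1 := fun z => by
      have hχ1 : χ z ≤ 1 := χ.le_one
      have hχ : 0 ≤ χ z := χ.nonneg
      rw [hα, norm_smul, Real.norm_of_nonneg (by positivity), mul_assoc]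
      refine mul_le_one₀ hχ1 (by positivity) ?_
      rw [div_mul_eq_mul_div, div_le_one (by positivity)]
      nlinarith [sq_nonneg (‖ω z‖ - 1)]
    have hχi : Integrable χ μ := χ.continuous.integrable_of_hasCompactSupport χ.hasCompactSupport
    have hαi : Integrable (fun z => α z (ξ z)) μ :=
      α.integrable_apply hξ (hn.mono fun z hz => hz.le)
    have hsq : Integrable (fun z => ‖sharp (ω z) - ξ z‖ ^ 2) (μ.restrict B) :=
      ((ω.memLp_sharp _).sub hξ2).integrable_norm_pow two_ne_zero
    have hpt : ∀ᵐ z ∂μ, χ z - α z (ξ z) ≤ B.indicator (fun z => ‖sharp (ω z) - ξ z‖ ^ 2) z := by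
      filter_upwards [hn] with z hz
      by_cases hzB : z ∈ B
      · have hχ1 : χ z ≤ 1 := χ.le_one
        have hχ : 0 ≤ χ z := χ.nonneg
        rw [indicator_of_mem hzB, hα]
        change χ z - χ z * (2 / (1 + ‖ω z‖ ^ 2)) * ω z (ξ z) ≤ _
        rw [norm_sub_sq_real, inner_sharp, norm_sharp, hz]
        have h1 : 0 ≤ ‖ω z‖ ^ 2 - 2 * ω z (ξ z) + 1 ^ 2 := by
          have := sq_nonneg ‖sharp (ω z) - ξ z‖
          rwa [norm_sub_sq_real, inner_sharp, norm_sharp, hz] at this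
        have h2 : χ z - χ z * (2 / (1 + ‖ω z‖ ^ 2)) * ω z (ξ z)
            = χ z * ((‖ω z‖ ^ 2 - 2 * ω z (ξ z) + 1 ^ 2) / (1 + ‖ω z‖ ^ 2)) := by
          field_simp
          ring
        rw [h2]
        refine (mul_le_of_le_one_left (by positivity) hχ1).trans ?_
        exact div_le_self h1 (by nlinarith [sq_nonneg ‖ω z‖])
      · rw [indicator_of_notMem hzB, hα]
        simp [hχ0 z hzB]
    have hint : ∫ z, χ z ∂μ - T α ≤ ε := by
      rw [hT, ← integral_sub hχi hαi]
      refine (integral_mono_ae (hχi.sub hαi)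
        ((integrable_indicator_iff Metric.isClosed_closedBall.measurableSet).2 hsq) hpt).trans ?_
      rw [integral_indicator Metric.isClosed_closedBall.measurableSet]
      exact hω.le
    calc μ (Metric.closedBall 0 n) ≤ ENNReal.ofReal (∫ z, χ z ∂μ) := by
          rw [ofReal_integral_eq_lintegral_ofReal hχi (ae_of_all _ fun z => χ.nonneg),
            ← lintegral_indicator_one Metric.isClosed_closedBall.measurableSet]
          refine lintegral_mono fun z => ?_
          by_cases hz : z ∈ Metric.closedBall (0 : E d) n
          · have : χ z = 1 := χ.one_of_mem_closedBall
              (Metric.closedBall_subset_closedBall (by simp [χ]) hz)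
            simp [hz, this]
          · simp [hz]
      _ ≤ ENNReal.ofReal (T α + ε) := ENNReal.ofReal_le_ofReal (by linarith)
      _ ≤ ENNReal.ofReal (T α) + ENNReal.ofReal ε := ENNReal.ofReal_add_le
      _ ≤ mass T + ε := by
          rw [ENNReal.ofReal_coe_nnreal]
          gcongr
          exact ofReal_le_mass T hα1
  rw [← Metric.iUnion_closedBall_nat (0 : E d), Monotone.measure_iUnion]
  · exact iSup_le hball
  · exact fun m n h => Metric.closedBall_subset_closedBall (by exact_mod_cast h)

end TransportPaths

/-! ### The density of a part that splits the mass -/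

namespace TransportPaths

variable {d : ℕ}

/-- A part that splits the mass is bounded in `L²`. -/
theorem apply_le_mul_norm_toL2 {T₁ T₂ : Current1 d} (h₁ : mass T₁ ≠ ∞) (h₂ : mass T₂ ≠ ∞)
    (hadd : mass T₁ + mass T₂ = mass (T₁ + T₂ : Current1 d)) {μ : Measure (E d)} [IsFiniteMeasure μ]
    {ξ : E d → E d} (hb : ∀ᵐ z ∂μ, ‖ξ z‖ ≤ 1)
    (hT : ∀ ω, (T₁ + T₂) ω = ∫ z, ω z (ξ z) ∂μ) (ω : Form1 d) :
    T₁ ω ≤ (1 + μ.real univ) / 2 * ‖toL2 μ ω‖ := by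
  set C := (1 + μ.real univ) / 2
  have hC : 0 < C := by positivity
  set B := ‖toL2 μ ω‖
  obtain ⟨K, hK⟩ := ω.hasCompactSupport.exists_bound_of_continuous ω.continuous
  have hsqi : Integrable (fun z => ‖ω z‖ ^ 2) μ :=
    Integrable.of_bound ω.contDiff_norm_sq.continuous.aestronglyMeasurable (K ^ 2)
      (ae_of_all _ fun z => by
        rw [Real.norm_of_nonneg (by positivity)]
        exact pow_le_pow_left₀ (norm_nonneg _) (hK z) 2)
  have key : ∀ t, B < t → T₁ ω ≤ C * t := by
    intro t ht
    have hB : 0 ≤ B := norm_nonneg _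
    have ht0 : 0 < t := hB.trans_lt ht
    -- the pointwise bound `‖ω‖ ≤ (‖ω‖² / t + t) / 2` is smooth in `z`, unlike `‖ω‖` itself
    have h := apply_add_apply_le h₁ h₂ hadd hb hT
      (g := fun z => t⁻¹ / 2 * ‖ω z‖ ^ 2 + t / 2) (K := t⁻¹ / 2 * K ^ 2 + t / 2)
      ((contDiff_const.mul ω.contDiff_norm_sq).add contDiff_const)
      (fun z => by
        have := pow_le_pow_left₀ (norm_nonneg _) (hK z) 2
        gcongr) (ω := ω) (ω' := 0)
      (fun z => by
        have h1 : t⁻¹ / 2 * ‖ω z‖ ^ 2 + t / 2 - ‖ω z‖ = t⁻¹ / 2 * (‖ω z‖ - t) ^ 2 := by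
          field_simp
          ring
        have h2 : 0 ≤ t⁻¹ / 2 * (‖ω z‖ - t) ^ 2 := by positivity
        linarith)
      (fun z => by
        change ‖(0 : E d →L[ℝ] ℝ)‖ ≤ _
        rw [norm_zero]
        positivity)
    rw [map_zero, add_zero, integral_add (hsqi.const_mul _) (integrable_const _),
      integral_const_mul, ← norm_sq_toL2 μ ω, integral_const, smul_eq_mul] at h
    have h3 : t⁻¹ / 2 * B ^ 2 ≤ t / 2 := by
      have : B ^ 2 ≤ t ^ 2 := pow_le_pow_left₀ hB ht.le 2
      calc t⁻¹ / 2 * B ^ 2 ≤ t⁻¹ / 2 * t ^ 2 := by gcongr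
        _ = t / 2 := by field_simp
    have h4 : C * t = t / 2 + μ.real univ * (t / 2) := by ring
    linarith
  by_contra! hlt
  have h1 : B < T₁ ω / C := by rw [lt_div_iff₀ hC]; linarith
  have h2 := key ((B + T₁ ω / C) / 2) (by linarith)
  have h3 : C * ((B + T₁ ω / C) / 2) = (C * B + T₁ ω) / 2 := by field_simp
  linarith

/-- A vector `v` with `‖v‖ + ‖ξ - v‖ ≤ 1 = ‖ξ‖` is a non-negative multiple of `ξ`. -/
theorem eq_norm_smul_of_norm_add_norm_sub_le {v ξ : E d} (hξ : ‖ξ‖ = 1)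
    (h : ‖v‖ + ‖ξ - v‖ ≤ 1) : v = ‖v‖ • ξ := by
  have h1 : inner ℝ v ξ + inner ℝ (ξ - v) ξ = 1 := by
    rw [← inner_add_left, add_sub_cancel, real_inner_self_eq_norm_sq, hξ, one_pow]
  have h2 := real_inner_le_norm v ξ
  have h3 := real_inner_le_norm (ξ - v) ξ
  rw [hξ, mul_one] at h2 h3
  have h4 : inner ℝ v ξ = ‖v‖ * ‖ξ‖ := by rw [hξ, mul_one]; linarith
  rw [inner_eq_norm_mul_iff_real, hξ, one_smul] at h4
  exact h4

/-- If the masses of two currents add up to the mass of their sum `ξ μ`, the first of them is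
`ρ ξ μ` with a density `0 ≤ ρ ≤ 1`. -/
theorem exists_density {T₁ T₂ : Current1 d} (h₁ : mass T₁ ≠ ∞) (h₂ : mass T₂ ≠ ∞)
    (hadd : mass T₁ + mass T₂ = mass (T₁ + T₂ : Current1 d)) {μ : Measure (E d)} [IsFiniteMeasure μ]
    {ξ : E d → E d} (hξ : AEStronglyMeasurable ξ μ) (hn : ∀ᵐ z ∂μ, ‖ξ z‖ = 1)
    (hT : ∀ ω, (T₁ + T₂) ω = ∫ z, ω z (ξ z) ∂μ) :
    ∃ ρ : E d → ℝ, Measurable ρ ∧ (∀ z, 0 ≤ ρ z) ∧ (∀ z, ρ z ≤ 1) ∧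
      ∀ ω, T₁ ω = ∫ z, ω z (ξ z) * ρ z ∂μ := by
  have hb : ∀ᵐ z ∂μ, ‖ξ z‖ ≤ 1 := hn.mono fun z hz => hz.le
  obtain ⟨v, hv⟩ := exists_inner_eq_of_le_norm (toL2 μ) (T₁ : Form1 d →ₗ[ℝ] ℝ)
    (apply_le_mul_norm_toL2 h₁ h₂ hadd hb hT)
  have hv' : ∀ ω : Form1 d, T₁ ω = ∫ z, ω z (v z) ∂μ := fun ω => by
    rw [← inner_toL2, ← hv]; rfl
  have hvi : Integrable v μ := (Lp.memLp v).integrable one_le_two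
  have hξi : Integrable ξ μ := Integrable.of_bound hξ 1 hb
  have hT₂ : ∀ ω : Form1 d, T₂ ω = ∫ z, ω z (ξ z) ∂μ - ∫ z, ω z (v z) ∂μ := fun ω => by
    rw [← hT, ← hv', add_apply, add_sub_cancel_left]
  have hab : ∀ a b : E d, ‖a‖ ≤ 1 → ‖b‖ ≤ 1 →
      ∀ᵐ z ∂μ, inner ℝ a (v z) + inner ℝ b (ξ z - v z) ≤ 1 := by
    intro a b ha hb1
    have i1 : Integrable (fun z => inner ℝ a (v z)) μ := hvi.const_inner a
    have i2 : Integrable (fun z => inner ℝ b (ξ z)) μ := hξi.const_inner b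
    have i3 : Integrable (fun z => inner ℝ b (v z)) μ := hvi.const_inner b
    have hfi : Integrable (fun z => inner ℝ a (v z) + (inner ℝ b (ξ z) - inner ℝ b (v z)) - 1) μ :=
      (i1.add (i2.sub i3)).sub (integrable_const _)
    have := ae_nonpos_of_integral_smooth_mul_nonpos hfi fun g hg hc hg0 hg1 => by
      have hm : ∀ f : E d → ℝ, Integrable f μ → Integrable (fun z => g z * f z) μ := fun f hf =>
        hf.bdd_mul hg.continuous.aestronglyMeasurable (c := 1)
          (ae_of_all _ fun z => by rw [Real.norm_of_nonneg (hg0 z)]; exact hg1 z)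
      have hform : ∀ c : E d, ‖c‖ ≤ 1 → ∀ z, ‖scalarForm g hg hc c z‖ ≤ g z := fun c hc1 z => by
        rw [norm_scalarForm, abs_of_nonneg (hg0 z)]
        exact mul_le_of_le_one_right (hg0 z) hc1
      have h := apply_add_apply_le h₁ h₂ hadd hb hT hg hg1 (hform a ha) (hform b hb1)
      rw [hv', hT₂] at h
      simp_rw [scalarForm_apply] at h
      have e : ∀ z, g z * (inner ℝ a (v z) + (inner ℝ b (ξ z) - inner ℝ b (v z)) - 1)
          = g z * inner ℝ a (v z) + (g z * inner ℝ b (ξ z) - g z * inner ℝ b (v z)) - g z * 1 :=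
        fun z => by ring
      simp_rw [e]
      have j1 : Integrable (fun z => g z * inner ℝ b (ξ z) - g z * inner ℝ b (v z)) μ :=
        (hm _ i2).sub (hm _ i3)
      have j2 : Integrable (fun z => g z * inner ℝ a (v z)
          + (g z * inner ℝ b (ξ z) - g z * inner ℝ b (v z))) μ := (hm _ i1).add j1
      rw [integral_sub j2 (hm _ (integrable_const _)), integral_add (hm _ i1) j1,
        integral_sub (hm _ i2) (hm _ i3)]
      simp_rw [mul_one]
      linarith
    filter_upwards [this] with z hz
    rw [inner_sub_right]
    linarith
  -- a countable dense set of pairs `(a, b)` gives one exceptional null set for all of them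
  let D := Metric.closedBall (0 : E d) 1
  have : Nonempty D := ⟨⟨0, by simp [D]⟩⟩
  have hall : ∀ᵐ z ∂μ, ∀ m n : ℕ, inner ℝ (denseSeq D m : E d) (v z)
      + inner ℝ (denseSeq D n : E d) (ξ z - v z) ≤ 1 := by
    rw [ae_all_iff]; intro m
    rw [ae_all_iff]; intro n
    exact hab _ _ (mem_closedBall_zero_iff.1 (denseSeq D m).2)
      (mem_closedBall_zero_iff.1 (denseSeq D n).2)
  have hpt : ∀ᵐ z ∂μ, v z = ‖v z‖ • ξ z ∧ ‖v z‖ ≤ 1 := by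
    filter_upwards [hall, hn] with z hz hnz
    have hD : ∀ a b : D, inner ℝ (a : E d) (v z) + inner ℝ (b : E d) (ξ z - v z) ≤ 1 := fun a b =>
      (denseRange_denseSeq D).induction_on₂ (isClosed_le (by fun_prop) continuous_const) hz a b
    have hu : ∀ w : E d, ‖w‖⁻¹ • w ∈ D ∧ inner ℝ (‖w‖⁻¹ • w) w = ‖w‖ := fun w => by
      refine ⟨?_, ?_⟩
      · simp only [D, mem_closedBall_zero_iff, norm_smul, norm_inv, norm_norm]
        exact inv_mul_le_one
      · rw [real_inner_smul_left, real_inner_self_eq_norm_sq]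
        by_cases h0 : ‖w‖ = 0
        · simp [h0]
        · field_simp
    have h := hD ⟨_, (hu (v z)).1⟩ ⟨_, (hu (ξ z - v z)).1⟩
    simp only [(hu _).2] at h
    exact ⟨eq_norm_smul_of_norm_add_norm_sub_le hnz h, by linarith [norm_nonneg (ξ z - v z)]⟩
  refine ⟨fun z => min ‖v z‖ 1, (Lp.stronglyMeasurable v).measurable.norm.min measurable_const,
    fun z => le_min (norm_nonneg _) zero_le_one, fun z => min_le_right _ _, fun ω => ?_⟩
  rw [hv']
  refine integral_congr_ae ?_
  filter_upwards [hpt] with z hz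
  rw [min_eq_left hz.2, mul_comm, ← smul_eq_mul, ← map_smul, ← hz.1]

/-- Zooming in at `x` by the factor `r⁻¹` scales one-dimensional integrals by `r⁻¹`. -/
theorem setIntegral_hausdorffMeasure_comp_dilation (A : Set (E d)) (F : E d → ℝ) (x : E d) {r : ℝ}
    (hr : 0 < r) :
    ∫ y in {y | x + r • y ∈ A}, F (x + r • y) ∂μH[1] = r⁻¹ * ∫ z in A, F z ∂μH[1] := by
  have hmap : Measure.map (fun y : E d => x + r • y) μH[1] = r.toNNReal⁻¹ • μH[1] := by
    have h1 := map_homothety_hausdorffMeasure (𝕜 := ℝ) (d := 1) zero_le_one (0 : E d) hr.ne'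
    have h2 := (IsometryEquiv.addLeft x).map_hausdorffMeasure 1
    have h3 : (fun y : E d => x + r • y)
        = (IsometryEquiv.addLeft x) ∘ (AffineMap.homothety (0 : E d) r) := by
      ext1 y; simp [AffineMap.homothety_apply]
    rw [h3, ← Measure.map_map (IsometryEquiv.addLeft x).continuous.measurable
      (AffineMap.homothety_continuous _ _).measurable, h1, Measure.map_smul, h2]
    congr 1
    rw [NNReal.rpow_one]
    congr 1
    ext
    simp [hr.le, abs_of_pos hr]
  have hemb : MeasurableEmbedding (fun y : E d => x + r • y) :=
    ((Homeomorph.smulOfNeZero r hr.ne').trans (Homeomorph.addLeft x)).measurableEmbedding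
  have := hemb.setIntegral_map (μ := μH[1]) F A
  rw [hmap, Measure.restrict_smul, integral_smul_nnreal_measure, NNReal.smul_def, smul_eq_mul,
    NNReal.coe_inv, Real.coe_toNNReal _ hr.le] at this
  exact this.symm

end TransportPaths

/-! ### Rectifiability of parts that split the mass -/

namespace TransportPaths

variable {d : ℕ}

/-- The measure `θ ℋ¹` on `M`. -/
noncomputable def weightedMeasure (M : Set (E d)) (θ : E d → ℝ) : Measure (E d) :=
  (μH[1].restrict M).withDensity fun z => ENNReal.ofReal (θ z)

theorem isLocallyFiniteMeasure_weightedMeasure {M : Set (E d)} {θ : E d → ℝ}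
    (hθ : LocallyIntegrable θ (μH[1].restrict M)) :
    IsLocallyFiniteMeasure (weightedMeasure M θ) := by
  refine ⟨fun x => ?_⟩
  obtain ⟨U, hU, hUi⟩ := hθ x
  obtain ⟨V, hVU, hV, hxV⟩ := mem_nhds_iff.1 hU
  refine ⟨V, hV.mem_nhds hxV, ?_⟩
  rw [weightedMeasure, withDensity_apply _ hV.measurableSet]
  refine lt_of_le_of_lt (lintegral_mono fun z => ?_) (hUi.mono_set hVU).2
  rw [Real.enorm_eq_ofReal_abs]
  exact ENNReal.ofReal_le_ofReal (le_abs_self _)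

theorem integral_weightedMeasure {M : Set (E d)} {θ : E d → ℝ} (hM : NullMeasurableSet M μH[1])
    (hpos : ∀ x ∈ M, 0 < θ x) (hθ : AEStronglyMeasurable θ (μH[1].restrict M)) (F : E d → ℝ) :
    ∫ z, F z ∂(weightedMeasure M θ) = ∫ z in M, F z * θ z ∂μH[1] := by
  rw [weightedMeasure, integral_withDensity_eq_integral_toReal_smul₀
    hθ.aemeasurable.ennreal_ofReal (ae_of_all _ fun _ => ENNReal.ofReal_lt_top)]
  refine integral_congr_ae ?_
  filter_upwards [ae_restrict_mem₀ hM] with z hz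
  rw [ENNReal.toReal_ofReal (hpos z hz).le, smul_eq_mul, mul_comm]

theorem ae_weightedMeasure_iff {M : Set (E d)} {θ : E d → ℝ} (hM : NullMeasurableSet M μH[1])
    (hpos : ∀ x ∈ M, 0 < θ x) (hθ : AEStronglyMeasurable θ (μH[1].restrict M)) {p : E d → Prop} :
    (∀ᵐ z ∂(weightedMeasure M θ), p z) ↔ ∀ᵐ z ∂(μH[1].restrict M), p z := by
  rw [weightedMeasure, ae_withDensity_iff' hθ.aemeasurable.ennreal_ofReal]
  refine ⟨fun h => ?_, fun h => h.mono fun z hz _ => hz⟩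
  filter_upwards [h, ae_restrict_mem₀ hM] with z hz hzM
  exact hz (by simpa using hpos z hzM)

/-- The approximate tangent line in terms of the rescalings about `x` of the measure `θ ℋ¹` on `M`. -/
theorem isApproxTangentLine_iff {M : Set (E d)} {θ : E d → ℝ} {x : E d} {P : Submodule ℝ (E d)} :
    IsApproxTangentLine M θ x P ↔ Module.finrank ℝ P = 1 ∧
      ∀ f : E d → ℝ, Continuous f → HasCompactSupport f →
        Tendsto (fun r : ℝ => r⁻¹ * ∫ z in M, f (r⁻¹ • (z - x)) * θ z ∂μH[1]) (𝓝[>] 0)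
          (𝓝 (θ x * ∫ y in (P : Set (E d)), f y ∂μH[1])) := by
  refine and_congr_right fun _ => forall₃_congr fun f _ _ => tendsto_congr' ?_
  filter_upwards [self_mem_nhdsWithin] with r (hr : 0 < r)
  rw [← setIntegral_hausdorffMeasure_comp_dilation M _ x hr]
  simp only [add_sub_cancel_left, inv_smul_smul₀ hr.ne']

/-- At a Lebesgue point of the bounded function `ρ`, multiplying the density by `ρ` does not change
the approximate tangent line. -/
theorem IsApproxTangentLine.mul_density {M : Set (E d)} {θ ρ : E d → ℝ} {x : E d}
    {P : Submodule ℝ (E d)} (hP : IsApproxTangentLine M θ x P) (hM : NullMeasurableSet M μH[1])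
    (hpos : ∀ x ∈ M, 0 < θ x) (hθ : LocallyIntegrable θ (μH[1].restrict M))
    (hρ : Measurable ρ) (hρ0 : ∀ z, 0 ≤ ρ z) (hρ1 : ∀ z, ρ z ≤ 1)
    (hx : Tendsto (fun r => ⨍ z in Metric.closedBall x r, ‖ρ z - ρ x‖ ∂(weightedMeasure M θ))
      (𝓝[>] 0) (𝓝 0)) :
    IsApproxTangentLine (M ∩ {z | 0 < ρ z}) (fun z => ρ z * θ z) x P := by
  rw [isApproxTangentLine_iff] at hP ⊢
  refine ⟨hP.1, fun f hf hfc => ?_⟩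
  have hloc := isLocallyFiniteMeasure_weightedMeasure hθ
  set μ := weightedMeasure M θ with hμ
  have hSm : MeasurableSet {z | 0 < ρ z} := measurableSet_lt measurable_const hρ
  have hres : ∀ F : E d → ℝ,
      ∫ z in M ∩ {z | 0 < ρ z}, F z * (ρ z * θ z) ∂μH[1] = ∫ z, F z * ρ z ∂μ := fun F => by
    rw [inter_comm, ← Measure.restrict_restrict hSm,
      integral_weightedMeasure hM hpos hθ.aestronglyMeasurable]
    simp_rw [← mul_assoc]
    refine setIntegral_eq_integral_of_forall_compl_eq_zero fun z hz => ?_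
    have : ρ z = 0 := le_antisymm (not_lt.1 hz) (hρ0 z)
    simp [this]
  have hP' : ∀ h : E d → ℝ, Continuous h → HasCompactSupport h →
      Tendsto (fun r : ℝ => r⁻¹ * ∫ z, h (r⁻¹ • (z - x)) ∂μ) (𝓝[>] 0)
        (𝓝 (θ x * ∫ y in (P : Set (E d)), h y ∂μH[1])) := fun h hh hhc => by
    simp_rw [hμ, integral_weightedMeasure hM hpos hθ.aestronglyMeasurable]
    exact hP.2 h hh hhc
  simp_rw [hres]
  obtain ⟨C, hC⟩ := hfc.exists_bound_of_continuous hf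
  have hC0 : 0 ≤ C := (norm_nonneg _).trans (hC 0)
  obtain ⟨R, hR0, hR⟩ := hfc.isCompact.isBounded.subset_closedBall_lt 0 0
  have hf0 : ∀ y, R < ‖y‖ → f y = 0 := fun y hy => by
    by_contra hne
    have := hR (subset_tsupport f hne)
    rw [mem_closedBall_zero_iff] at this
    exact this.not_gt hy
  -- the rescalings of `χ` bound `r⁻¹ μ(B(x, r R))`; this ball contains the support of the rescaled `f`
  let χ : ContDiffBump (0 : E d) := ⟨R, R + 1, hR0, by linarith⟩
  have hχc : Continuous χ := χ.continuous
  have hscale : ∀ (h : E d → ℝ), Continuous h → HasCompactSupport h → ∀ r : ℝ, 0 < r →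
      Integrable (fun z => h (r⁻¹ • (z - x))) μ := fun h hh hhc r hr => by
    refine Continuous.integrable_of_hasCompactSupport (by fun_prop) ?_
    exact hhc.comp_homeomorph
      ((Homeomorph.subRight x).trans (Homeomorph.smulOfNeZero r⁻¹ (inv_ne_zero hr.ne')))
  have hbound : ∀ r : ℝ, 0 < r →
      ‖r⁻¹ * ∫ z, f (r⁻¹ • (z - x)) * ρ z ∂μ - ρ x * (r⁻¹ * ∫ z, f (r⁻¹ • (z - x)) ∂μ)‖
      ≤ C * ((r⁻¹ * ∫ z, χ (r⁻¹ • (z - x)) ∂μ)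
        * ⨍ z in Metric.closedBall x (r * R), ‖ρ z - ρ x‖ ∂μ) := by
    intro r hr
    set B := Metric.closedBall x (r * R)
    have hBfin : μ B ≠ ∞ := (isCompact_closedBall _ _).measure_lt_top.ne
    have hBf : IsFiniteMeasure (μ.restrict B) := isFiniteMeasure_restrict.2 hBfin
    have hBm : MeasurableSet B := Metric.isClosed_closedBall.measurableSet
    have hin : ∀ z, z ∈ B ↔ ‖r⁻¹ • (z - x)‖ ≤ R := fun z => by
      rw [Metric.mem_closedBall, dist_eq_norm, norm_smul, norm_inv, Real.norm_of_nonneg hr.le,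
        inv_mul_le_iff₀ hr]
    have hfi := hscale f hf hfc r hr
    have hfρ : Integrable (fun z => f (r⁻¹ • (z - x)) * ρ z) μ :=
      hfi.mul_bdd hρ.aestronglyMeasurable (c := 1) (ae_of_all _ fun z => by
        rw [Real.norm_of_nonneg (hρ0 z)]; exact hρ1 z)
    have hρi : Integrable (fun z => ‖ρ z - ρ x‖) (μ.restrict B) :=
      Integrable.of_bound (hρ.sub_const _).norm.aestronglyMeasurable 1 (ae_of_all _ fun z => by
        rw [norm_norm, Real.norm_eq_abs, abs_le]
        constructor <;> linarith [hρ0 z, hρ1 z, hρ0 x, hρ1 x])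
    have e1 : ‖∫ z, f (r⁻¹ • (z - x)) * (ρ z - ρ x) ∂μ‖ ≤ C * ∫ z in B, ‖ρ z - ρ x‖ ∂μ := by
      rw [← integral_const_mul, ← integral_indicator hBm]
      refine norm_integral_le_of_norm_le ?_ (ae_of_all _ fun z => ?_)
      · exact (integrable_indicator_iff hBm).2 (hρi.const_mul C)
      · by_cases hz : z ∈ B
        · rw [indicator_of_mem hz, norm_mul]
          exact mul_le_mul_of_nonneg_right (hC _) (norm_nonneg _)
        · rw [indicator_of_notMem hz, hf0 _ (not_le.1 (mt (hin z).2 hz)), zero_mul, norm_zero]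
    have e2 : μ.real B ≤ ∫ z, χ (r⁻¹ • (z - x)) ∂μ := by
      rw [← integral_indicator_one hBm]
      refine integral_mono ((integrable_indicator_iff hBm).2 (integrable_const _))
        (hscale χ hχc χ.hasCompactSupport r hr) fun z => ?_
      by_cases hz : z ∈ B
      · have : χ (r⁻¹ • (z - x)) = 1 :=
          χ.one_of_mem_closedBall (mem_closedBall_zero_iff.2 ((hin z).1 hz))
        rw [indicator_of_mem hz, this, Pi.one_apply]
      · rw [indicator_of_notMem hz]
        exact χ.nonneg
    have e3 : ∫ z in B, ‖ρ z - ρ x‖ ∂μ = μ.real B * ⨍ z in B, ‖ρ z - ρ x‖ ∂μ :=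
      (measure_smul_setAverage _ hBfin).symm
    have e4 : 0 ≤ ⨍ z in B, ‖ρ z - ρ x‖ ∂μ := integral_nonneg fun z => norm_nonneg _
    have e5 : r⁻¹ * ∫ z, f (r⁻¹ • (z - x)) * ρ z ∂μ - ρ x * (r⁻¹ * ∫ z, f (r⁻¹ • (z - x)) ∂μ)
        = r⁻¹ * ∫ z, f (r⁻¹ • (z - x)) * (ρ z - ρ x) ∂μ := by
      simp_rw [mul_sub]
      rw [integral_sub hfρ (hfi.mul_const _), integral_mul_const]
      ring
    rw [e5, norm_mul, norm_inv, Real.norm_of_nonneg hr.le]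
    calc r⁻¹ * ‖∫ z, f (r⁻¹ • (z - x)) * (ρ z - ρ x) ∂μ‖
        ≤ r⁻¹ * (C * (μ.real B * ⨍ z in B, ‖ρ z - ρ x‖ ∂μ)) := by rw [← e3]; gcongr
      _ ≤ r⁻¹ * (C * ((∫ z, χ (r⁻¹ • (z - x)) ∂μ) * ⨍ z in B, ‖ρ z - ρ x‖ ∂μ)) := by gcongr
      _ = _ := by ring
  have hRlim : Tendsto (fun r : ℝ => r * R) (𝓝[>] 0) (𝓝[>] 0) := by
    refine tendsto_nhdsWithin_iff.2 ⟨?_, ?_⟩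
    · have : Tendsto (fun r : ℝ => r * R) (𝓝 0) (𝓝 (0 * R)) := tendsto_id.mul_const R
      rw [zero_mul] at this
      exact this.mono_left nhdsWithin_le_nhds
    · filter_upwards [self_mem_nhdsWithin] with r hr using mul_pos hr hR0
  have hlim0 := ((hP' χ hχc χ.hasCompactSupport).mul (hx.comp hRlim)).const_mul C
  rw [mul_zero, mul_zero] at hlim0
  have hdiff := squeeze_zero_norm' (f := fun r : ℝ => r⁻¹ * ∫ z, f (r⁻¹ • (z - x)) * ρ z ∂μ
    - ρ x * (r⁻¹ * ∫ z, f (r⁻¹ • (z - x)) ∂μ))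
    (by filter_upwards [self_mem_nhdsWithin] with r hr using hbound r hr) hlim0
  have := hdiff.add ((hP' f hf hfc).const_mul (ρ x))
  simp only [sub_add_cancel, zero_add, ← mul_assoc] at this
  simpa only [← mul_assoc] using this

/-- A part of a rectifiable current of finite mass that splits the mass is rectifiable: it has the
same orientation, and its multiplicity is the product of the multiplicity of the whole and of a
density with values in `[0, 1]`. -/
theorem IsRectifiable.of_mass_add_eq {T₁ T₂ : Current1 d} (hrect : IsRectifiable (T₁ + T₂))
    (hfin : mass (T₁ + T₂ : Current1 d) ≠ ∞)
    (hadd : mass T₁ + mass T₂ = mass (T₁ + T₂ : Current1 d)) : IsRectifiable T₁ := by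
  obtain ⟨M, θ, ξ, hM, hMr, hpos, hθ, hξ, htan, hT⟩ := hrect
  have hθm := hθ.aestronglyMeasurable
  have hloc := isLocallyFiniteMeasure_weightedMeasure hθ
  set μ := weightedMeasure M θ with hμ
  have hac : μ ≪ μH[1].restrict M := withDensity_absolutelyContinuous _ _
  have hTμ : ∀ ω, (T₁ + T₂) ω = ∫ z, ω z (ξ z) ∂μ := fun ω => by
    rw [hT, hμ, integral_weightedMeasure hM hpos hθm]; rfl
  have hn : ∀ᵐ z ∂μ, ‖ξ z‖ = 1 := (ae_weightedMeasure_iff hM hpos hθm).2 (htan.mono fun z hz => hz.1)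
  have hξμ : AEStronglyMeasurable ξ μ := hξ.mono_ac hac
  have hμfin : IsFiniteMeasure μ :=
    ⟨(measure_univ_le_mass hξμ hn hTμ).trans_lt (lt_top_iff_ne_top.2 hfin)⟩
  rw [← hadd] at hfin
  obtain ⟨ρ, hρ, hρ0, hρ1, hT₁⟩ := exists_density (ENNReal.add_ne_top.1 hfin).1
    (ENNReal.add_ne_top.1 hfin).2 hadd hξμ hn hTμ
  have hSm : MeasurableSet {z | 0 < ρ z} := measurableSet_lt measurable_const hρ
  have hleb : ∀ᵐ x ∂μ, Tendsto
      (fun r => ⨍ z in Metric.closedBall x r, ‖ρ z - ρ x‖ ∂μ) (𝓝[>] 0) (𝓝 0) := by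
    have hρi : LocallyIntegrable ρ μ :=
      (Integrable.of_bound hρ.aestronglyMeasurable 1 (ae_of_all _ fun z => by
        rw [Real.norm_of_nonneg (hρ0 z)]; exact hρ1 z)).locallyIntegrable
    filter_upwards [(Besicovitch.vitaliFamily μ).ae_tendsto_average_norm_sub hρi] with x hx
    exact hx.comp (Besicovitch.tendsto_filterAt μ x)
  have hle : μH[1].restrict (M ∩ {z | 0 < ρ z}) ≤ μH[1].restrict M :=
    Measure.restrict_mono inter_subset_left le_rfl
  refine ⟨M ∩ {z | 0 < ρ z}, fun z => ρ z * θ z, ξ, hM.inter hSm.nullMeasurableSet, ?_,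
    fun x hx => mul_pos hx.2 (hpos x hx.1), ?_, hξ.mono_measure hle, ?_, fun ω => ?_⟩
  · obtain ⟨M₀, F, h0, hF, hsub⟩ := hMr
    exact ⟨M₀, F, h0, hF, inter_subset_left.trans hsub⟩
  · refine (hθ.mono_measure hle).mono (hρ.aestronglyMeasurable.mul (hθm.mono_measure hle))
      (ae_of_all _ fun z => ?_)
    rw [norm_mul, Real.norm_of_nonneg (hρ0 z)]
    exact mul_le_of_le_one_left (norm_nonneg _) (hρ1 z)
  · refine ae_mono hle ?_
    filter_upwards [htan, (ae_weightedMeasure_iff hM hpos hθm).1 hleb] with z hz hlz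
    obtain ⟨h1, P, hP, hξP⟩ := hz
    exact ⟨h1, P, hP.mul_density hM hpos hθ hρ hρ0 hρ1 hlz, hξP⟩
  · rw [hT₁, hμ, integral_weightedMeasure hM hpos hθm, tauFunctional, inter_comm,
      ← Measure.restrict_restrict hSm]
    simp_rw [← mul_assoc]
    refine (setIntegral_eq_integral_of_forall_compl_eq_zero fun z hz => ?_).symm
    have : ρ z = 0 := le_antisymm (not_lt.1 hz) (hρ0 z)
    simp [this]

theorem IsRectifiable.neg {T : Current1 d} (h : IsRectifiable T) : IsRectifiable (-T) := by
  obtain ⟨M, θ, ξ, hM, hMr, hpos, hθ, hξ, htan, hT⟩ := h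
  refine ⟨M, θ, -ξ, hM, hMr, hpos, hθ, hξ.neg, ?_, fun ω => ?_⟩
  · filter_upwards [htan] with z ⟨h1, P, hP, hξP⟩
    exact ⟨by rwa [Pi.neg_apply, norm_neg], P, hP, P.neg_mem hξP⟩
  · rw [neg_apply, hT]
    simp [tauFunctional, integral_neg]

end TransportPaths

/-! ### Stair-shaped matrices and compatible maps -/

namespace TransportPaths

variable {d : ℕ}

/-- The non-zero entries of a stair-shaped matrix form a chain for the product order. -/
theorem IsStairMatrix.le_or_le {M N : ℕ∞} {A : Matrix (Idx M) (Idx N) ℝ≥0} (hA : IsStairMatrix A)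
    {i i' : Idx M} {j j' : Idx N} (h : A i j ≠ 0) (h' : A i' j' ≠ 0) :
    ((i : ℕ) ≤ i' ∧ (j : ℕ) ≤ j') ∨ ((i' : ℕ) ≤ i ∧ (j' : ℕ) ≤ j) := by
  obtain ⟨r, c, -, hmono, hzero⟩ := hA
  obtain ⟨k, hk, hrk, hck⟩ := not_not.1 (mt (hzero i j) h)
  obtain ⟨l, hl, hrl, hcl⟩ := not_not.1 (mt (hzero i' j') h')
  rw [← hrk, ← hck, ← hrl, ← hcl]
  rcases le_total k l with hkl | hkl
  · exact Or.inl (hmono k l hkl hl)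
  · exact Or.inr (hmono l k hkl hk)

/-- A relation that is a chain for the product order is covered by the graph of a map `φ` and the
transposed graph of a map `ψ`. Here `φ` sends each row to its first non-zero column. If an entry is
not the first one of its row, then it is the first one of its column, for otherwise the first entries
of its row and of its column would be incomparable. -/
theorem exists_maps_of_chain {α : Type*} {S S' : Set α} {i j : α → ℕ} (hi : InjOn i S)
    (hj : InjOn j S') {R : α → α → Prop}
    (hR : ∀ p ∈ S, ∀ q ∈ S', ∀ p' ∈ S, ∀ q' ∈ S', R p q → R p' q' →
      (i p ≤ i p' ∧ j q ≤ j q') ∨ (i p' ≤ i p ∧ j q' ≤ j q)) :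
    ∃ φ ψ : α → α, (∀ p ∈ S, ∀ q ∈ S', R p q → q = φ p ∨ p = ψ q) ∧
      (∀ p ∉ S, φ p = p) ∧ (∀ p, φ p = p ∨ φ p ∈ S') ∧
      (∀ q ∉ S', ψ q = q) ∧ (∀ q, ψ q = q ∨ ψ q ∈ S) := by
  have hφ : ∀ p, ∃ q, (∀ q' ∈ S', p ∈ S → R p q' → q ∈ S' ∧ R p q ∧ j q ≤ j q') ∧
      (p ∉ S → q = p) ∧ (q = p ∨ q ∈ S') := by
    intro p
    by_cases h : p ∈ S ∧ ∃ q ∈ S', R p q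
    · obtain ⟨hp, q₀, hq₀, hR₀⟩ := h
      obtain ⟨q, hq, hmin⟩ :=
        (measure j).wf.has_min {q | q ∈ S' ∧ R p q} ⟨q₀, hq₀, hR₀⟩
      exact ⟨q, fun q' hq' _ hR' => ⟨hq.1, hq.2, not_lt.1 (hmin q' ⟨hq', hR'⟩)⟩, fun h => absurd hp h,
        Or.inr hq.1⟩
    · exact ⟨p, fun q' hq' hp hR' => absurd ⟨hp, q', hq', hR'⟩ h, fun _ => rfl, Or.inl rfl⟩
  choose φ hφ1 hφ2 hφ3 using hφ
  have hψ : ∀ q, ∃ p, (∀ p' ∈ S, q ∈ S' → R p' q → q ≠ φ p' → p = p') ∧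
      (q ∉ S' → p = q) ∧ (p = q ∨ p ∈ S) := by
    intro q
    by_cases h : q ∈ S' ∧ ∃ p ∈ S, R p q ∧ q ≠ φ p
    · obtain ⟨hq, p, hp, hRp, hne⟩ := h
      refine ⟨p, fun p' hp' _ hR' hne' => ?_, fun h => absurd hq h, Or.inr hp⟩
      have key : ∀ p ∈ S, R p q → q ≠ φ p → ∀ p' ∈ S, R p' q → i p ≤ i p' := by
        intro p hp hRp hne p' hp' hR'
        obtain ⟨hm, hRm, hle⟩ := hφ1 p q hq hp hRp
        have hlt : j (φ p) < j q := lt_of_le_of_ne hle fun he => hne (hj hq hm he.symm)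
        rcases hR p hp _ hm p' hp' q hq hRm hR' with h | h
        · exact h.1
        · exact absurd h.2 hlt.not_ge
      exact hi hp hp' (le_antisymm (key p hp hRp hne p' hp' hR') (key p' hp' hR' hne' p hp hRp))
    · exact ⟨q, fun p' hp' hq hR' hne => absurd ⟨hq, p', hp', hR', hne⟩ h, fun _ => rfl,
        Or.inl rfl⟩
  choose ψ hψ1 hψ2 hψ3 using hψ
  refine ⟨φ, ψ, fun p hp q hq hRpq => ?_, hφ2, hφ3, hψ2, hψ3⟩
  by_cases h : q = φ p
  · exact Or.inl h
  · exact Or.inr (hψ1 q p hp hq hRpq h).symm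

theorem ae_atomic_mem_range {ι : Type} [Countable ι] (x : ι → E d) (m : ι → ℝ≥0) :
    ∀ᵐ z ∂(atomic x m), z ∈ range x := by
  refine Measure.ae_sum_iff.2 fun i => ?_
  refine Measure.ae_smul_measure ?_ _
  exact (ae_dirac_iff (countable_range x).measurableSet).2 (mem_range_self i)

/-- A map that moves only countably many points is measurable. -/
theorem measurable_of_forall_notMem_eq {α : Type*} [MeasurableSpace α] [MeasurableSingletonClass α]
    {S : Set α} (hS : S.Countable) {φ : α → α} (h : ∀ p ∉ S, φ p = p) : Measurable φ :=
  measurable_id.measurable_of_countable_ne (hS.mono fun p hp => by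
    by_contra hpS
    exact hp (h p hpS).symm)

theorem isTransportPair_map {X : Set (E d)} (hX : MeasurableSet X) {κ : Measure (Curve d)}
    [IsFiniteMeasure κ] (hs : ∀ᵐ γ ∂κ, γ.startPoint ∈ X) (he : ∀ᵐ γ ∂κ, γ.endPoint ∈ X) :
    IsTransportPair X (κ.map Curve.startPoint) (κ.map Curve.endPoint) where
  finite_left := inferInstance
  finite_right := inferInstance
  left_supported := by
    rw [Measure.map_apply Curve.measurable_startPoint hX.compl]
    exact hs
  right_supported := by
    rw [Measure.map_apply Curve.measurable_endPoint hX.compl]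
    exact he
  mass_eq := by
    rw [Measure.map_apply Curve.measurable_startPoint .univ,
      Measure.map_apply Curve.measurable_endPoint .univ, preimage_univ, preimage_univ]

/-- A current that is an integral of curves whose end points are a function of their starting points
is compatible with that function. -/
theorem isCompatibleMap_of_ae_eq {X : Set (E d)} {S : Current1 d} {κ : Measure (Curve d)}
    (hpath : IsTransportPath X S (κ.map Curve.startPoint) (κ.map Curve.endPoint))
    [IsFiniteMeasure κ] (hint : IsIntegralOfCurves S κ)
    (hκ : ∀ᵐ γ ∂κ, γ.IsNonconstant ∧ γ.IsSimple) {φ : E d → E d} (hφ : Measurable φ)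
    (hφX : MapsTo φ X X) (h : ∀ᵐ γ ∂κ, γ.endPoint = φ γ.startPoint) :
    IsTransportMap X φ (κ.map Curve.startPoint) (κ.map Curve.endPoint) ∧
      IsCompatibleMap X (κ.map Curve.startPoint) (κ.map Curve.endPoint) S φ := by
  have hgraph : Measurable fun z : E d => (z, φ z) := measurable_id.prodMk hφ
  have hpair : (κ.map Curve.startPoint).map (fun z => (z, φ z))
      = κ.map fun γ => (γ.startPoint, γ.endPoint) := by
    rw [Measure.map_map hgraph Curve.measurable_startPoint]
    refine Measure.map_congr ?_
    filter_upwards [h] with γ hγ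
    simp [hγ]
  have hmap : IsTransportMap X φ (κ.map Curve.startPoint) (κ.map Curve.endPoint) :=
    { pair := hpath.pair
      measurable := hφ
      mapsTo := hφX
      map_eq := by
        rw [Measure.map_map hφ Curve.measurable_startPoint]
        refine Measure.map_congr ?_
        filter_upwards [h] with γ hγ using hγ.symm }
  refine ⟨hmap, hmap, hpath, ⟨hpath.pair, ?_, ?_⟩, κ, inferInstance, hκ.mono fun γ hγ => hγ.2, hint,
    hpair⟩
  · rw [Measure.map_map measurable_fst hgraph]
    exact Measure.map_id
  · rw [Measure.map_map measurable_snd hgraph]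
    exact hmap.map_eq

end TransportPaths

theorem mainTheorem3 {d : ℕ} (X : Set (E d)) (hXcompact : IsCompact X) (hXconvex : Convex ℝ X)
    {M N : ℕ∞} (x : Idx M → E d) (m' : Idx M → ℝ≥0) (y : Idx N → E d) (m : Idx N → ℝ≥0)
    (hx : ∀ i, x i ∈ X) (hy : ∀ j, y j ∈ X)
    (hmass : ∑' i, (m' i : ℝ≥0∞) = ∑' j, (m j : ℝ≥0∞)) (hfinite : ∑' j, (m j : ℝ≥0∞) < ∞)
    (T : Current1 d) (hT : IsTransportPath X T (atomic x m') (atomic y m))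
    (hstair : IsStairShaped x m' y m T) :
    ∃ (μ₁minus μ₂minus μ₁plus μ₂plus : Measure (E d)) (T₁ T₂ : Current1 d),
      atomic x m' = μ₁minus + μ₂minus ∧ atomic y m = μ₁plus + μ₂plus ∧ T = T₁ + T₂ ∧
      (IsSubcurrent T₁ T ∧ IsTransportPath X T₁ μ₁minus μ₁plus) ∧
      (IsSubcurrent T₂ T ∧ IsTransportPath X T₂ μ₂minus μ₂plus) ∧
      ∃ φ ψ : E d → E d,
        IsTransportMap X φ μ₁minus μ₁plus ∧ IsTransportMap X ψ μ₂plus μ₂minus ∧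
        IsCompatibleMap X μ₁minus μ₁plus T₁ φ ∧ IsCompatibleMap X μ₂plus μ₂minus (-T₂) ψ := by
  obtain ⟨η, hη, hstart, hend, hA⟩ := hstair
  have hηfin := hη.finite
  have hTfin : mass T ≠ ∞ := ((le_self_add).trans_lt hη.normal).ne
  have hX : MeasurableSet X := hXcompact.measurableSet
  have hsx : ∀ᵐ γ ∂η, γ.startPoint ∈ range x :=
    ae_of_ae_map Curve.measurable_startPoint.aemeasurable (hstart ▸ ae_atomic_mem_range x m')
  have hey : ∀ᵐ γ ∂η, γ.endPoint ∈ range y :=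
    ae_of_ae_map Curve.measurable_endPoint.aemeasurable (hend ▸ ae_atomic_mem_range y m)
  have hsX : ∀ᵐ γ ∂η, γ.startPoint ∈ X := hsx.mono fun γ hγ => range_subset_iff.2 hx hγ
  have heX : ∀ᵐ γ ∂η, γ.endPoint ∈ X := hey.mono fun γ hγ => range_subset_iff.2 hy hγ
  -- repeated points `x i` are represented by one of their indices
  have hidx : ∀ {K : ℕ∞} (w : Idx K → E d), ∃ i : E d → ℕ, InjOn i (range w) ∧
      ∀ p ∈ range w, ∃ k, w k = p ∧ (k : ℕ) = i p := fun {K} w => by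
    classical
    refine ⟨fun p => if h : p ∈ range w then (h.choose : ℕ) else 0, ?_, fun p hp =>
      ⟨hp.choose, hp.choose_spec, by simp only [dif_pos hp]⟩⟩
    intro p hp q hq hpq
    simp only [dif_pos hp, dif_pos hq] at hpq
    rw [← hp.choose_spec, ← hq.choose_spec, Subtype.ext hpq]
  obtain ⟨i, hi, hix⟩ := hidx x
  obtain ⟨j, hj, hjy⟩ := hidx y
  obtain ⟨φ, ψ, hφψ, hφx, hφy, hψy, hψx⟩ := exists_maps_of_chain hi hj
    (R := fun p q => η (Curve.between p q) ≠ 0) (by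
      intro p hp q hq p' hp' q' hq' hR hR'
      obtain ⟨k, rfl, hk⟩ := hix p hp
      obtain ⟨l, rfl, hl⟩ := hjy q hq
      obtain ⟨k', rfl, hk'⟩ := hix p' hp'
      obtain ⟨l', rfl, hl'⟩ := hjy q' hq'
      rw [← hk, ← hl, ← hk', ← hl']
      exact hA.le_or_le (ENNReal.toNNReal_ne_zero.2 ⟨hR, measure_ne_top _ _⟩)
        (ENNReal.toNNReal_ne_zero.2 ⟨hR', measure_ne_top _ _⟩))
  have hφm : Measurable φ := measurable_of_forall_notMem_eq (countable_range x) hφx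
  have hψm : Measurable ψ := measurable_of_forall_notMem_eq (countable_range y) hψy
  have hφX : MapsTo φ X X := fun p hp => by
    rcases hφy p with h | h
    · rwa [h]
    · exact range_subset_iff.2 hy h
  have hψX : MapsTo ψ X X := fun q hq => by
    rcases hψx q with h | h
    · rwa [h]
    · exact range_subset_iff.2 hx h
  have hcover : ∀ᵐ γ ∂η, γ.endPoint = φ γ.startPoint ∨ γ.startPoint = ψ γ.endPoint := by
    have hnull : ∀ᵐ γ ∂η, ∀ (k : Idx M) (l : Idx N), η (Curve.between (x k) (y l)) = 0 →
        γ ∉ Curve.between (x k) (y l) := by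
      simp_rw [ae_all_iff]
      exact fun k l h => measure_eq_zero_iff_ae_notMem.1 h
    filter_upwards [hnull, hsx, hey] with γ hγ ⟨k, hk⟩ ⟨l, hl⟩
    refine hφψ _ ⟨k, hk⟩ _ ⟨l, hl⟩ fun h0 => ?_
    rw [← hk, ← hl] at h0
    exact hγ k l h0 ⟨hk.symm, hl.symm⟩
  set B : Set (Curve d) := {γ | γ.endPoint = φ γ.startPoint} with hBdef
  have hB : MeasurableSet B :=
    measurableSet_eq_fun Curve.measurable_endPoint (hφm.comp Curve.measurable_startPoint)
  have hB₁ : ∀ᵐ γ ∂(η.restrict B), γ.endPoint = φ γ.startPoint := ae_restrict_mem hB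
  have hB₂ : ∀ᵐ γ ∂(η.restrict Bᶜ), γ.startPoint = ψ γ.endPoint := by
    filter_upwards [ae_restrict_of_ae hcover, ae_restrict_mem hB.compl] with γ h1 h2
    exact h1.resolve_left h2
  have hfin : ∫⁻ γ, mass γ.toFunctional ∂(η.restrict B) ≠ ∞ :=
    ((setLIntegral_le_lintegral _ _).trans_lt (hη.mass_eq ▸ hTfin.lt_top)).ne
  have hns₁ := ae_restrict_of_ae (s := B) hη.supported
  have hns₂ := ae_restrict_of_ae (s := Bᶜ) hη.supported
  obtain ⟨T₁, hT₁⟩ := exists_isIntegralOfCurves hns₁ (fun ω => (hη.integral ω).1.restrict) hfin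
  obtain ⟨T₂, rfl⟩ : ∃ T₂, T = T₁ + T₂ := ⟨T - T₁, (add_sub_cancel T₁ T).symm⟩
  have hT₂ : IsIntegralOfCurves T₂ (η.restrict Bᶜ) := fun ω => by
    refine ⟨(hη.integral ω).1.restrict, ?_⟩
    have h := (hη.integral ω).2
    rw [← integral_add_compl hB (hη.integral ω).1, ← (hT₁ ω).2, add_apply] at h
    exact add_left_cancel h
  have hmasses := IsIntegralOfCurves.mass_add_mass_eq hB hη.mass_eq hT₁ hT₂ rfl
  have hr₁ : IsRectifiable T₁ := hT.rectifiable.of_mass_add_eq hTfin hmasses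
  have hr₂ : IsRectifiable T₂ := by
    have hrect := hT.rectifiable
    rw [add_comm T₁ T₂] at hrect hTfin hmasses
    rw [add_comm (mass T₁)] at hmasses
    exact hrect.of_mass_add_eq hTfin hmasses
  have hpath₁ : IsTransportPath X T₁ ((η.restrict B).map Curve.startPoint)
      ((η.restrict B).map Curve.endPoint) :=
    ⟨isTransportPair_map hX (ae_restrict_of_ae hsX) (ae_restrict_of_ae heX), hr₁,
      hT₁.boundary_eq hns₁⟩
  have hpath₂ : IsTransportPath X T₂ ((η.restrict Bᶜ).map Curve.startPoint)
      ((η.restrict Bᶜ).map Curve.endPoint) :=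
    ⟨isTransportPair_map hX (ae_restrict_of_ae hsX) (ae_restrict_of_ae heX), hr₂,
      hT₂.boundary_eq hns₂⟩
  -- the curves of the second part, run backwards
  set κ := (η.restrict Bᶜ).map Curve.reverseEquiv with hκ
  have hκs : κ.map Curve.startPoint = (η.restrict Bᶜ).map Curve.endPoint := by
    rw [hκ, Measure.map_map Curve.measurable_startPoint Curve.reverseEquiv.measurable]
    congr 1
    exact funext Curve.startPoint_reverse
  have hκe : κ.map Curve.endPoint = (η.restrict Bᶜ).map Curve.startPoint := by
    rw [hκ, Measure.map_map Curve.measurable_endPoint Curve.reverseEquiv.measurable]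
    congr 1
    exact funext Curve.endPoint_reverse
  have hκns : ∀ᵐ γ ∂κ, γ.IsNonconstant ∧ γ.IsSimple := by
    rw [hκ, Curve.reverseEquiv.measurableEmbedding.ae_map_iff]
    filter_upwards [hns₂] with γ hγ
    exact ⟨γ.reverse_isNonconstant_iff.2 hγ.1, hγ.2.reverse hγ.1⟩
  have hκψ : ∀ᵐ γ ∂κ, γ.endPoint = ψ γ.startPoint := by
    rw [hκ, Curve.reverseEquiv.measurableEmbedding.ae_map_iff]
    filter_upwards [hB₂] with γ hγ
    change γ.reverse.endPoint = ψ γ.reverse.startPoint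
    rw [Curve.endPoint_reverse, Curve.startPoint_reverse, hγ]
  have hκint : IsIntegralOfCurves (-T₂) κ := hT₂.map_reverse hns₂
  have hκpath : IsTransportPath X (-T₂) (κ.map Curve.startPoint) (κ.map Curve.endPoint) := by
    have h := hpath₂.pair
    refine ⟨?_, hr₂.neg, hκint.boundary_eq hκns⟩
    rw [hκs, hκe]
    exact ⟨h.finite_right, h.finite_left, h.right_supported, h.left_supported, h.mass_eq.symm⟩
  obtain ⟨hφmap, hφcomp⟩ := isCompatibleMap_of_ae_eq hpath₁ hT₁ hns₁ hφm hφX hB₁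
  obtain ⟨hψmap, hψcomp⟩ := isCompatibleMap_of_ae_eq hκpath hκint hκns hψm hψX hκψ
  rw [hκs, hκe] at hψmap hψcomp
  refine ⟨_, _, _, _, T₁, T₂, ?_, ?_, rfl, ⟨?_, hpath₁⟩, ⟨?_, hpath₂⟩, φ, ψ, hφmap, hψmap, hφcomp,
    hψcomp⟩
  · rw [← hstart, ← Measure.map_add _ _ Curve.measurable_startPoint,
      Measure.restrict_add_restrict_compl hB]
  · rw [← hend, ← Measure.map_add _ _ Curve.measurable_endPoint,
      Measure.restrict_add_restrict_compl hB]
  · rw [IsSubcurrent, add_sub_cancel_left, add_comm]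
    exact hmasses
  · rw [IsSubcurrent, add_sub_cancel_right]
    exact hmasses
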